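/- **Notation.** Let $n$ be a natural number, let $e_1,\dots,e_n$ be the canonical basis of $\mathbb Z^n$, and let $|c|=c_1+\dots+c_n$ be the modulus of $c\in\mathbb Z_{\ge0}^n$. For a finite set $A\subset\mathbb Z_{\ge0}^n$ and $k\ge1$ put $$\mathcal P_k(A)=\Big\{\sum_{a\in A}\kappa_a a+\sum_{i=1}^n h_ie_i\ :\ \kappa_a,h_i\in\mathbb Z_{\ge0},\ \sum_{a\in A}\kappa_a\ge k\Big\},\qquad \overline{\mathcal P}_k(A)=\operatorname{conv}_{\mathbb R^n}(\mathcal P_k(A))\cap\mathbb Z_{\ge0}^n .$$ For finite sets $A\subset\mathbb Z_{\ge0}^n$ and $B\subseteq\{e_1,\dots,e_n\}$, a *solution* of the integer program $\overline P_{A,B,k}$ is a vector $c\in\mathbb Z_{\ge0}^n$ such that for all $d\in\mathbb Z_{\ge0}^n$: $c+d\in\overline{\mathcal P}_k(A)$ if and only if $d\in\mathcal P_1(B)$. It is *optimal* if $|c|$ is minimal among all solutions. Let $K$ be a field and $S=K[x_1,\dots,x_n]$. For $A\subset\mathbb Z_{\ge0}^n$ let $I(A)\subseteq S$ be the ideal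 generated by the monomials $x^a$, $a\in A$. The integral closure of an ideal $I$ is denoted by $\overline I$. For a filtration $\mathcal I=\{I_{[k]}\}_{k\ge0}$ of ideals of $S$ ($I_{[0]}=S$, $I_{[k+1]}\subseteq I_{[k]}$, $I_{[k]}I_{[l]}\subseteq I_{[k+l]}$) let $\operatorname{Ass}^\infty(\mathcal I)$ be the set of the primes that belong to $\operatorname{Ass}(S/I_{[k]})$ for infinitely many $k$. Let $\mathcal R=\bigoplus_{k\ge0}I_{[k]}$ be the Rees algebra and $\mathcal R'=\bigoplus_{k\ge0}I_{[k+1]}\subseteq\mathcal R$ the ideal with $k$-th component $I_{[k+1]}$. For an ideal $\mathfrak p$ of $S$ let $\mathfrak q$ be the product of all $\mathfrak p_1\in\operatorname{Ass}^\infty(\mathcal I)$ with $\mathfrak p\subsetneq\mathfrak p_1$ ($\mathfrak q=S$ if there are none), and define the $\mathcal R$-module $$\operatorname{Soc}^*_{\mathfrak p}(\mathcal I)=\frac{\mathcal R':_{\mathcal R}\mathfrak p\mathcal R}{\bigcup_{N\ge0}\big(\mathcal R':_{\mathcal R}(\mathfrak p+\mathfrak q^N)\mathcal R\big)} .$$ **Theorem.**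 Let $K$ be a field, and let $A,B\subset\mathbb Z_{\ge0}^n$ be non-empty finite subsets such that $0\notin A$ and $B\subseteq\{e_1,\dots,e_n\}$. Then the following conditions are equivalent. (a) The integer program $\overline P_{A,B,k}$ has a solution for all $k\gg0$. (b) $I(B)=(x_i:e_i\in B)\in\operatorname{Ass}^\infty(\{\overline{I(A)^k}\}_{k\ge0})$. (c) The Krull dimension of the $\mathcal R$-module $\operatorname{Soc}^*_{I(B)}(\{\overline{I(A)^k}\}_{k\ge0})$ is positive. Furthermore, if these equivalent conditions hold, then for all $k\gg0$ an optimal solution of $\overline P_{A,B,k}$ exists and its modulus is quasi-linear in $k$ for $k\gg0$: there are a period $s\ge1$ and integers $a_i,b_i$, $i=0,\dots,s-1$, such that for all $k\gg0$ the modulus equals $a_ik+b_i$ whenever $k\equiv i\pmod s$. -/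

import Mathlib

open Filter Polynomial

/-! ### Integral closure of an ideal -/

/-- `r` is integral over the ideal `I`: it satisfies an equation
`r ^ m + a₁ r ^ (m - 1) + ⋯ + aₘ = 0` with `m ≥ 1` and `aᵢ ∈ I ^ i`. -/
def IsIntegralOverIdeal {R : Type*} [CommRing R] (I : Ideal R) (r : R) : Prop :=
  ∃ m : ℕ, 0 < m ∧ ∃ a : ℕ → R, (∀ i ∈ Finset.Icc 1 m, a i ∈ I ^ i) ∧
    r ^ m + ∑ i ∈ Finset.Icc 1 m, a i * r ^ (m - i) = 0

/-- `r` is integral over `I ^ k` iff `r t ^ k` is integral over the Rees algebra of `I`. -/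
theorem isIntegralOverIdeal_pow_iff {R : Type*} [CommRing R] (I : Ideal R) (k : ℕ) (r : R) :
    IsIntegralOverIdeal (I ^ k) r ↔ IsIntegral (reesAlgebra I) (monomial k r : R[X]) := by
  constructor
  · rintro ⟨m, hm, a, ha, h⟩
    have hmem : ∀ i ∈ Finset.Icc 1 m, (monomial (k * i) (a i) : R[X]) ∈ reesAlgebra I := by
      intro i hi
      rw [reesAlgebra.monomial_mem, pow_mul]
      exact ha i hi
    classical
    let c : ℕ → reesAlgebra I := fun i =>
      if hi : i ∈ Finset.Icc 1 m then ⟨monomial (k * i) (a i), hmem i hi⟩ else 0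
    let p : (reesAlgebra I)[X] := X ^ m + ∑ i ∈ Finset.Icc 1 m, C (c i) * X ^ (m - i)
    refine ⟨p, ?_, ?_⟩
    · apply monic_X_pow_add
      refine (degree_sum_le _ _).trans_lt ?_
      rw [Finset.sup_lt_iff (by exact_mod_cast WithBot.bot_lt_coe m)]
      intro i hi
      refine (degree_C_mul_X_pow_le _ _).trans_lt ?_
      rw [Finset.mem_Icc] at hi
      exact_mod_cast (by omega : m - i < m)
    · have hc : ∀ i ∈ Finset.Icc 1 m,
          (algebraMap (reesAlgebra I) R[X]) (c i) = monomial (k * i) (a i) := by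
        intro i hi
        simp only [c, dif_pos hi]
        rfl
      simp only [p, eval₂_add, eval₂_pow, eval₂_X, eval₂_finsetSum, eval₂_mul, eval₂_C]
      have : ∀ i ∈ Finset.Icc 1 m,
          (algebraMap (reesAlgebra I) R[X]) (c i) * (monomial k r : R[X]) ^ (m - i)
            = monomial (k * m) (a i * r ^ (m - i)) := by
        intro i hi
        rw [hc i hi, monomial_pow, monomial_mul_monomial, ← mul_add]
        rw [Finset.mem_Icc] at hi
        rw [show i + (m - i) = m by omega]
      rw [Finset.sum_congr rfl this, monomial_pow, ← map_sum, ← map_add, h, map_zero]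
  · rintro ⟨p, hp, h⟩
    rcases subsingleton_or_nontrivial R with hR | hR
    · exact ⟨1, one_pos, fun _ => 0, fun _ _ => Ideal.zero_mem _, Subsingleton.elim _ _⟩
    have : Nontrivial (reesAlgebra I) := inferInstance
    -- multiply the relation by the variable to make its degree positive
    have hq : (X * p).Monic := monic_X.mul hp
    have hdeg : (X * p).natDegree = p.natDegree + 1 := by
      rw [monic_X.natDegree_mul hp, natDegree_X, add_comm]
    have hz : eval₂ (algebraMap (reesAlgebra I) R[X]) (monomial k r) (X * p) = 0 := by
      rw [eval₂_mul, h, mul_zero]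
    generalize X * p = q at hq hdeg hz
    set m := q.natDegree with hm
    refine ⟨m, by omega, fun i => (q.coeff (m - i) : R[X]).coeff (k * i), ?_, ?_⟩
    · intro i _
      rw [← pow_mul]
      exact (q.coeff (m - i)).2 (k * i)
    · have h1 := congrArg (fun f : R[X] => f.coeff (k * m)) hz
      simp only [coeff_zero] at h1
      rw [eval₂_eq_sum_range, ← hm, Finset.sum_range_succ, coeff_add, finsetSum_coeff] at h1
      have hlead : q.coeff m = 1 := hq
      rw [hlead, map_one, one_mul, monomial_pow, coeff_monomial, if_pos rfl, add_comm] at h1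
      rw [← h1]
      congr 1
      refine Finset.sum_bij' (fun i _ => m - i) (fun j _ => m - j) ?_ ?_ ?_ ?_ ?_
      · intro i hi
        rw [Finset.mem_Icc] at hi
        rw [Finset.mem_range]
        omega
      · intro j hj
        rw [Finset.mem_range] at hj
        rw [Finset.mem_Icc]
        omega
      · intro i hi
        rw [Finset.mem_Icc] at hi
        omega
      · intro j hj
        rw [Finset.mem_range] at hj
        omega
      · intro i hi
        rw [Finset.mem_Icc] at hi
        have he : k * m = k * i + k * (m - i) := by
          rw [← mul_add]
          congr 1
          omega
        rw [monomial_pow, ← C_mul_X_pow_eq_monomial, ← mul_assoc, he, coeff_mul_X_pow,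
          coeff_mul_C]
        rfl

/-- The integral closure of an ideal `I`: the ideal of all elements integral over `I`. -/
def idealClosure {R : Type*} [CommRing R] (I : Ideal R) : Ideal R where
  carrier := {r | IsIntegralOverIdeal I r}
  add_mem' {x y} hx hy := by
    have e := isIntegralOverIdeal_pow_iff I 1
    simp only [pow_one] at e
    simp only [Set.mem_ofPred_eq, e] at hx hy ⊢
    rw [map_add]
    exact hx.add hy
  zero_mem' := ⟨1, one_pos, fun _ => 0, fun _ _ => Ideal.zero_mem _, by simp⟩
  smul_mem' c {x} hx := by
    have e := isIntegralOverIdeal_pow_iff I 1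
    simp only [pow_one] at e
    simp only [Set.mem_ofPred_eq, e] at hx ⊢
    have h2 : (monomial 1 (c • x) : R[X]) =
        algebraMap (reesAlgebra I) R[X] (algebraMap R (reesAlgebra I) c) * monomial 1 x := by
      change monomial 1 (c • x) = C c * monomial 1 x
      rw [C_mul_monomial, smul_eq_mul]
    rw [h2]
    exact isIntegral_algebraMap.mul hx

theorem mem_idealClosure {R : Type*} [CommRing R] (I : Ideal R) (r : R) :
    r ∈ idealClosure I ↔ IsIntegralOverIdeal I r := Iff.rfl

/-! ### Filtrations, Rees algebras and the module `Soc` -/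

/-- A filtration of a ring by ideals `R = I_[0] ⊇ I_[1] ⊇ ⋯` with
`I_[k] I_[l] ⊆ I_[k + l]`. -/
structure IdealFiltration (R : Type*) [CommRing R] where
  /-- the `k`-th member of the filtration -/
  toFun : ℕ → Ideal R
  zero_eq : toFun 0 = ⊤
  succ_le : ∀ k, toFun (k + 1) ≤ toFun k
  mul_le : ∀ k l, toFun k * toFun l ≤ toFun (k + l)

/-- The filtration of the integral closures of the powers of an ideal. -/
def closurePowers {R : Type*} [CommRing R] (I : Ideal R) : IdealFiltration R where
  toFun k := idealClosure (I ^ k)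
  zero_eq := by
    rw [Ideal.eq_top_iff_one, mem_idealClosure, isIntegralOverIdeal_pow_iff, monomial_zero_left,
      C_1]
    exact isIntegral_one
  succ_le k := by
    rintro r ⟨m, hm, a, ha, h⟩
    exact ⟨m, hm, a, fun i hi => Ideal.pow_right_mono (Ideal.pow_le_pow_right k.le_succ) i
      (ha i hi), h⟩
  mul_le k l := by
    rw [Ideal.mul_le]
    intro r hr s hs
    rw [mem_idealClosure, isIntegralOverIdeal_pow_iff] at hr hs ⊢
    rw [← monomial_mul_monomial]
    exact hr.mul hs

namespace IdealFiltration

/-- `Ass^∞` of a filtration: the primes associated to `I_[k]` (that is, associated primes of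
`R ⧸ I_[k]`) for infinitely many `k`. -/
def assInfty {R : Type*} [CommRing R] (F : IdealFiltration R) : Set (Ideal R) :=
  {p | {k : ℕ | p ∈ associatedPrimes R (R ⧸ F.toFun k)}.Infinite}

/-- The Rees algebra `⨁ₖ I_[k] tᵏ`, realized inside `R[t]`. -/
def rees {R : Type*} [CommRing R] (F : IdealFiltration R) : Subalgebra R R[X] where
  carrier := {f | ∀ k, f.coeff k ∈ F.toFun k}
  mul_mem' hf hg k := by
    rw [coeff_mul]
    apply Ideal.sum_mem
    rintro ⟨i, j⟩ e
    rw [← Finset.HasAntidiagonal.mem_antidiagonal.mp e]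
    exact F.mul_le i j (Ideal.mul_mem_mul (hf i) (hg j))
  add_mem' hf hg k := by
    rw [coeff_add]
    exact Ideal.add_mem _ (hf k) (hg k)
  algebraMap_mem' r k := by
    rw [Polynomial.algebraMap_apply, coeff_C]
    split_ifs with h
    · subst h
      rw [F.zero_eq]
      trivial
    · exact Ideal.zero_mem _

/-- The Rees algebra as a type of its own, with its ring structure and its structure of an
`R`-algebra. -/
def ReesRing {R : Type*} [CommRing R] (F : IdealFiltration R) : Type _ := F.rees

noncomputable instance {R : Type*} [CommRing R] (F : IdealFiltration R) : CommRing F.ReesRing :=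
  inferInstanceAs (CommRing F.rees)

noncomputable instance {R : Type*} [CommRing R] (F : IdealFiltration R) : Algebra R F.ReesRing :=
  inferInstanceAs (Algebra R F.rees)

/-- The inclusion of the Rees algebra into `R[t]`. -/
noncomputable def reesVal {R : Type*} [CommRing R] (F : IdealFiltration R) :
    F.ReesRing →ₐ[R] R[X] :=
  F.rees.val

theorem coeff_reesVal_mem {R : Type*} [CommRing R] (F : IdealFiltration R) (f : F.ReesRing)
    (k : ℕ) : (F.reesVal f).coeff k ∈ F.toFun k :=
  Subtype.property (p := fun x : R[X] => x ∈ F.rees) f k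

/-- The ideal `⨁ₖ I_[k + 1] tᵏ` of the Rees algebra: the Rees algebra shifted by one. -/
def reesShift {R : Type*} [CommRing R] (F : IdealFiltration R) : Ideal F.ReesRing where
  carrier := {f | ∀ k, (F.reesVal f).coeff k ∈ F.toFun (k + 1)}
  add_mem' {f g} hf hg k := by
    rw [map_add, coeff_add]
    exact Ideal.add_mem _ (hf k) (hg k)
  zero_mem' k := by
    rw [map_zero, coeff_zero]
    exact Ideal.zero_mem _
  smul_mem' c {f} hf k := by
    rw [smul_eq_mul, map_mul, coeff_mul]
    apply Ideal.sum_mem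
    rintro ⟨i, j⟩ e
    rw [← Finset.HasAntidiagonal.mem_antidiagonal.mp e, add_assoc]
    exact F.mul_le i (j + 1) (Ideal.mul_mem_mul (F.coeff_reesVal_mem c i) (hf j))

/-- The product `𝔮` of the primes of `Ass^∞` strictly containing `p`, and `𝔮 = R` if there are
none. -/
noncomputable def socProd {R : Type*} [CommRing R] (F : IdealFiltration R) (p : Ideal R) :
    Ideal R :=
  ∏ᶠ p' ∈ {p' : Ideal R | p' ∈ F.assInfty ∧ p < p'}, p'

/-- The numerator `ℛ' :_ℛ pℛ` of `Soc`. -/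
noncomputable def socNum {R : Type*} [CommRing R] (F : IdealFiltration R) (p : Ideal R) :
    Ideal F.ReesRing :=
  F.reesShift.colon (p.map (algebraMap R F.ReesRing) : Set F.ReesRing)

/-- The denominator `ℛ' :_ℛ (p + 𝔮^∞)ℛ = ⋃_N (ℛ' :_ℛ (p + 𝔮^N)ℛ)` of `Soc`. The union is an
increasing one, so that it is the supremum. -/
noncomputable def socDen {R : Type*} [CommRing R] (F : IdealFiltration R) (p : Ideal R) :
    Ideal F.ReesRing :=
  ⨆ N : ℕ, F.reesShift.colon ((p ⊔ F.socProd p ^ N).map (algebraMap R F.ReesRing) : Set F.ReesRing)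

/-- `Soc*_p` of a filtration, a module over its Rees algebra. (The denominator is contained in the
numerator.) -/
abbrev Soc {R : Type*} [CommRing R] (F : IdealFiltration R) (p : Ideal R) : Type _ :=
  F.socNum p ⧸ (F.socDen p).submoduleOf (F.socNum p)

end IdealFiltration

/-! ### Monomial ideals and the integer programs -/

/-- The monomial ideal of `K[x₁, …, xₙ]` generated by the monomials `x^a`, `a ∈ A`. -/
noncomputable def monomialIdeal (K : Type*) [Field K] {n : ℕ} (A : Set (Fin n →₀ ℕ)) :
    Ideal (MvPolynomial (Fin n) K) :=
  Ideal.span ((fun a => MvPolynomial.monomial a (1 : K)) '' A)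

/-- `𝒫ₖ(A)`: the lattice points `∑ κ_a a + ∑ hᵢ eᵢ` with `κ_a, hᵢ ≥ 0` integers and
`∑ κ_a ≥ k`. -/
def latticeSet {n : ℕ} (A : Finset (Fin n →₀ ℕ)) (k : ℕ) : Set (Fin n →₀ ℕ) :=
  {v | ∃ (κ : (Fin n →₀ ℕ) → ℕ) (h : Fin n → ℕ), k ≤ ∑ a ∈ A, κ a ∧
    v = ∑ a ∈ A, κ a • a + ∑ i, h i • Finsupp.single i 1}

/-- An integral vector as a point of `ℝⁿ`. -/
def toReal {n : ℕ} (v : Fin n →₀ ℕ) : Fin n → ℝ := fun i => (v i : ℝ)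

/-- The lattice points of the convex hull of `𝒫ₖ(A)` in `ℝⁿ`. -/
def closedLatticeSet {n : ℕ} (A : Finset (Fin n →₀ ℕ)) (k : ℕ) : Set (Fin n →₀ ℕ) :=
  {v | toReal v ∈ convexHull ℝ (toReal '' latticeSet A k)}

/-- `c` is a solution (a feasible point) of the integer program for `A`, `B`, `k`: for every
`d`, the point `c + d` is in `closedLatticeSet A k` if and only if `d ∈ 𝒫₁(B)`. -/
def IsSolution {n : ℕ} (A B : Finset (Fin n →₀ ℕ)) (k : ℕ) (c : Fin n →₀ ℕ) : Prop :=
  ∀ d : Fin n →₀ ℕ, c + d ∈ closedLatticeSet A k ↔ d ∈ latticeSet B 1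

/-- `c` is an optimal solution: a solution of minimal modulus `|c| = c₁ + ⋯ + cₙ`. -/
def IsOptimalSolution {n : ℕ} (A B : Finset (Fin n →₀ ℕ)) (k : ℕ) (c : Fin n →₀ ℕ) : Prop :=
  IsSolution A B k c ∧ ∀ c', IsSolution A B k c' → c.degree ≤ c'.degree

/-- `f` agrees for all large `k` with a quasi-linear function: there are a period `s ≥ 1` and
linear functions `aᵢ k + bᵢ`, `i = 0, …, s - 1`, such that `f k = aᵢ k + bᵢ` for all large
`k ≡ i` modulo `s`. -/
def IsEventuallyQuasiLinear (f : ℕ → ℕ) : Prop :=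
  ∃ s : ℕ, 0 < s ∧ ∃ a b : Fin s → ℤ,
    ∀ᶠ k : ℕ in atTop, ∀ i : Fin s, k % s = i → (f k : ℤ) = a i * k + b i

/-! The exponents of the monomials in the integral closure of `I(A)^k` are the lattice points of `k`
times the Newton polyhedron. One inclusion uses monomial valuations, the other a Dickson argument
producing an integral multiple. A solution is thus an exponent `c` for which the colon of this ideal
by `x^c` is `I(B)`. Associated primes of monomial ideals are generated by variables, and for the
prime `I(B)` the witness may be taken to be a monomial. Hence the program at level `k` is solvable
exactly when `I(B)` is associated to the `k`-th closure
(`exists_isSolution_iff_mem_associatedPrimes`).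

Persistence comes from cancellation: if `v + a` is at level `k + 1` for all `a ∈ A`, then `v` is at
level `k`. Together with primality of `I(B)` this shows that some `a ∈ A` carries a solution to a
solution one level up. A pigeonhole argument then yields a single `a`, a ray, that can be added
forever (`IsSolution.exists_isRay`). So solvability at one level gives solvability at all higher
ones, and (a) and (b) agree.

If `I(B)` is not in `Ass^∞`, each coefficient of an element of the numerator of `Soc` has a colon
ideal whose minimal primes are asymptotic primes strictly above `I(B)`. A power of `𝔮` therefore
lies in the colon, and `Soc = 0`. Conversely, let `c` solve level `m + 1` and lie at level `m`, and
let `a` be a ray of `c`. The class of `x^c t^m` survives multiplication by every `τ^i (1 - τ g)`,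
where `τ = x^a t`. This produces two primes `P < Q` in the support, with `τ ∈ Q` but `τ ∉ P`.

For the optimum, sort solutions by their rays of least degree. A point of `A` occurring often in a
decomposition of a translated solution is a ray of it, so a solution whose least ray degree is `δ`
has modulus at least `δ k - C`. Moving along a ray adds exactly its degree. These two facts make the
minimum eventually linear, with period one. -/

/-- The `k`-th dilate of the Newton polyhedron of `A`: the points that dominate a nonnegative real
combination of the points of `A` with sum of coefficients `k`. -/
def newtonPolyhedron {n : ℕ} (A : Finset (Fin n →₀ ℕ)) (k : ℝ) : Set (Fin n → ℝ) :=
  {x | ∃ t : (Fin n →₀ ℕ) → ℝ, (∀ a, 0 ≤ t a) ∧ ∑ a ∈ A, t a = k ∧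
    ∀ i, ∑ a ∈ A, t a * (a i : ℝ) ≤ x i}

/-! ### Newton polyhedra and their lattice points -/

section Convexity

open scoped Pointwise

variable {n : ℕ} {A : Finset (Fin n →₀ ℕ)}

theorem convex_newtonPolyhedron (k : ℝ) : Convex ℝ (newtonPolyhedron A k) := by
  rintro x ⟨s, hs0, hs, hsx⟩ y ⟨t, ht0, ht, hty⟩ p q hp hq hpq
  refine ⟨fun a => p * s a + q * t a, fun a => ?_, ?_, fun i => ?_⟩
  · have := hs0 a
    have := ht0 a
    positivity
  · rw [Finset.sum_add_distrib, ← Finset.mul_sum, ← Finset.mul_sum, hs, ht, ← add_mul, hpq, one_mul]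
  · simp only [add_mul, Finset.sum_add_distrib, mul_assoc, ← Finset.mul_sum, Pi.add_apply,
      Pi.smul_apply, smul_eq_mul]
    gcongr
    · exact hsx i
    · exact hty i

/-- It is the Minkowski sum of a compact set and the closed orthant; closedness is what strict
separation needs. -/
theorem isClosed_newtonPolyhedron (k : ℝ) : IsClosed (newtonPolyhedron A k) := by
  classical
  let K : Set ((Fin n →₀ ℕ) → ℝ) := (Set.univ.pi fun _ => Set.Icc 0 k) ∩ {t | ∑ a ∈ A, t a = k}
  have hK : IsCompact K := by
    refine (isCompact_univ_pi fun _ => isCompact_Icc).inter_right ?_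
    exact isClosed_eq (by fun_prop) continuous_const
  let L : ((Fin n →₀ ℕ) → ℝ) → (Fin n → ℝ) := fun t i => ∑ a ∈ A, t a * (a i : ℝ)
  have hL : Continuous L := by fun_prop
  have h : newtonPolyhedron A k = L '' K + Set.Ici 0 := by
    ext x
    rw [Set.mem_add]
    constructor
    · rintro ⟨t, ht0, ht, htx⟩
      have hsum : ∀ f : (Fin n →₀ ℕ) → ℝ,
          ∑ a ∈ A, (if a ∈ A then t a else 0) * f a = ∑ a ∈ A, t a * f a :=
        fun f => Finset.sum_congr rfl fun a ha => by rw [if_pos ha]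
      -- Compactness bounds the coefficients at every index, so those outside `A` are reset to zero.
      refine ⟨L t, ⟨fun a => if a ∈ A then t a else 0, ⟨fun a _ => ?_, ?_⟩, ?_⟩, x - L t, ?_, ?_⟩
      · dsimp only
        split_ifs with ha
        · exact ⟨ht0 a, ht ▸ Finset.single_le_sum (fun a _ => ht0 a) ha⟩
        · exact ⟨le_rfl, ht ▸ Finset.sum_nonneg fun a _ => ht0 a⟩
      · simp [ht]
      · funext i
        exact hsum fun a => a i
      · exact fun i => sub_nonneg.2 (htx i)
      · simp
    · rintro ⟨_, ⟨t, ⟨ht0, ht⟩, rfl⟩, y, hy, rfl⟩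
      refine ⟨fun a => |t a|, fun a => abs_nonneg _, ?_, fun i => ?_⟩
      · rw [← show ∑ a ∈ A, t a = k from ht]
        exact Finset.sum_congr rfl fun a _ => abs_of_nonneg (ht0 a trivial).1
      · have : ∑ a ∈ A, |t a| * (a i : ℝ) = L t i :=
          Finset.sum_congr rfl fun a _ => by rw [abs_of_nonneg (ht0 a trivial).1]
        rw [this]
        simpa using hy i
  rw [h]
  exact IsClosed.add_left_of_isCompact isClosed_Ici (hK.image hL)

theorem newtonPolyhedron_mono {k : ℝ} {x y : Fin n → ℝ} (hx : x ∈ newtonPolyhedron A k)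
    (hxy : x ≤ y) : y ∈ newtonPolyhedron A k := by
  obtain ⟨t, ht0, ht, htx⟩ := hx
  exact ⟨t, ht0, ht, fun i => (htx i).trans (hxy i)⟩

theorem newtonPolyhedron_antitone {k l : ℝ} (hl : 0 ≤ l) (hlk : l ≤ k) :
    newtonPolyhedron A k ⊆ newtonPolyhedron A l := by
  rintro x ⟨t, ht0, ht, htx⟩
  have hk := hl.trans hlk
  refine ⟨fun a => l / k * t a, fun a => mul_nonneg (by positivity) (ht0 a), ?_, fun i => ?_⟩
  · rw [← Finset.mul_sum, ht]
    rcases hk.eq_or_lt with rfl | hk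
    · simp [le_antisymm hlk hl]
    · field_simp
  · simp only [mul_assoc, ← Finset.mul_sum]
    refine le_trans (mul_le_of_le_one_left ?_ (div_le_one_of_le₀ hlk hk)) (htx i)
    exact Finset.sum_nonneg fun a _ => mul_nonneg (ht0 a) (Nat.cast_nonneg _)

theorem newtonPolyhedron_add {k l : ℝ} {x y : Fin n → ℝ} (hx : x ∈ newtonPolyhedron A k)
    (hy : y ∈ newtonPolyhedron A l) : x + y ∈ newtonPolyhedron A (k + l) := by
  obtain ⟨s, hs0, hs, hsx⟩ := hx
  obtain ⟨t, ht0, ht, hty⟩ := hy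
  refine ⟨fun a => s a + t a, fun a => add_nonneg (hs0 a) (ht0 a), ?_, fun i => ?_⟩
  · rw [Finset.sum_add_distrib, hs, ht]
  · simp only [add_mul, Finset.sum_add_distrib]
    exact add_le_add (hsx i) (hty i)

theorem mem_latticeSet_iff {k : ℕ} {v : Fin n →₀ ℕ} :
    v ∈ latticeSet A k ↔ ∃ (κ : (Fin n →₀ ℕ) → ℕ) (h : Fin n →₀ ℕ),
      k ≤ ∑ a ∈ A, κ a ∧ v = ∑ a ∈ A, κ a • a + h := by
  have key : ∀ h : Fin n → ℕ, ∑ i, h i • Finsupp.single i 1 = Finsupp.equivFunOnFinite.symm h := by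
    intro h
    ext j
    simp [Finsupp.finsetSum_apply, Finsupp.single_apply]
  constructor
  · rintro ⟨κ, h, hκ, rfl⟩
    exact ⟨κ, _, hκ, by rw [key]⟩
  · rintro ⟨κ, h, hκ, rfl⟩
    exact ⟨κ, h, hκ, by rw [key]; congr 1; ext; rfl⟩

theorem latticeSet_mono {k : ℕ} {u v : Fin n →₀ ℕ} (hu : u ∈ latticeSet A k) (huv : u ≤ v) :
    v ∈ latticeSet A k := by
  rw [mem_latticeSet_iff] at hu ⊢
  obtain ⟨κ, h, hκ, rfl⟩ := hu
  exact ⟨κ, h + (v - (∑ a ∈ A, κ a • a + h)), hκ, by rw [← add_assoc, add_tsub_cancel_of_le huv]⟩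

theorem latticeSet_add {k l : ℕ} {u v : Fin n →₀ ℕ} (hu : u ∈ latticeSet A k)
    (hv : v ∈ latticeSet A l) : u + v ∈ latticeSet A (k + l) := by
  rw [mem_latticeSet_iff] at hu hv ⊢
  obtain ⟨κ, h, hκ, rfl⟩ := hu
  obtain ⟨κ', h', hκ', rfl⟩ := hv
  refine ⟨κ + κ', h + h', ?_, ?_⟩
  · simp only [Pi.add_apply, Finset.sum_add_distrib]
    exact add_le_add hκ hκ'
  · simp only [Pi.add_apply, add_smul, Finset.sum_add_distrib]
    abel

theorem mem_latticeSet_one {B : Finset (Fin n →₀ ℕ)} {v : Fin n →₀ ℕ} :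
    v ∈ latticeSet B 1 ↔ ∃ b ∈ B, b ≤ v := by
  classical
  rw [mem_latticeSet_iff]
  constructor
  · rintro ⟨κ, h, hκ, rfl⟩
    obtain ⟨b, hb, hκb⟩ : ∃ b ∈ B, κ b ≠ 0 :=
      Finset.exists_ne_zero_of_sum_ne_zero (by omega)
    refine ⟨b, hb, le_trans ?_ (self_le_add_right _ h)⟩
    refine le_trans ?_ (Finset.single_le_sum (f := fun a => κ a • a) (fun _ _ => zero_le) hb)
    intro i
    rw [Finsupp.smul_apply, smul_eq_mul]
    exact Nat.le_mul_of_pos_left _ (Nat.pos_of_ne_zero hκb)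
  · rintro ⟨b, hb, hbv⟩
    refine ⟨Pi.single b 1, v - b, ?_, ?_⟩
    · simp [Pi.single_apply, hb]
    · have : ∑ a ∈ B, (Pi.single b 1 : (Fin n →₀ ℕ) → ℕ) a • a = b := by
        rw [Finset.sum_eq_single_of_mem b hb (fun a _ hab => by simp [hab])]
        simp
      rw [this, add_tsub_cancel_of_le hbv]

theorem toReal_add (u v : Fin n →₀ ℕ) : toReal (u + v) = toReal u + toReal v := by
  funext i
  simp [toReal]

theorem toReal_sum_smul_apply (κ : (Fin n →₀ ℕ) → ℕ) (i : Fin n) :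
    toReal (∑ a ∈ A, κ a • a) i = ∑ a ∈ A, (κ a : ℝ) * (a i : ℝ) := by
  simp [toReal, Finsupp.finsetSum_apply]

theorem toReal_mem_newtonPolyhedron_of_mem_latticeSet {k : ℕ} {v : Fin n →₀ ℕ}
    (hv : v ∈ latticeSet A k) : toReal v ∈ newtonPolyhedron A k := by
  rw [mem_latticeSet_iff] at hv
  obtain ⟨κ, h, hκ, rfl⟩ := hv
  refine newtonPolyhedron_antitone (k := ∑ a ∈ A, (κ a : ℝ)) (Nat.cast_nonneg _)
    (by exact_mod_cast hκ) ⟨fun a => κ a, fun a => Nat.cast_nonneg _, rfl, fun i => ?_⟩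
  rw [← toReal_sum_smul_apply]
  simp [toReal]

theorem mem_convexHull_toReal_of_nonneg {x : Fin n → ℝ} (hx : 0 ≤ x) :
    x ∈ convexHull ℝ (Set.range (toReal (n := n))) := by
  have h : Set.range (toReal (n := n)) = Set.univ.pi fun _ => Set.range ((↑) : ℕ → ℝ) := by
    ext y
    simp only [Set.mem_range, Set.mem_univ_pi]
    constructor
    · rintro ⟨v, rfl⟩ i
      exact ⟨v i, rfl⟩
    · intro hy
      choose v hv using hy
      exact ⟨Finsupp.equivFunOnFinite.symm v, funext hv⟩
  rw [h, convexHull_pi]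
  intro i _
  have hseg : x i ∈ segment ℝ ((⌊x i⌋₊ : ℕ) : ℝ) ((⌊x i⌋₊ + 1 : ℕ) : ℝ) := by
    rw [segment_eq_Icc (by simp)]
    exact ⟨Nat.floor_le (hx i), by simpa using (Nat.lt_floor_add_one (x i)).le⟩
  exact segment_subset_convexHull (Set.mem_range_self _) (Set.mem_range_self _) hseg

/-- For `k > 0`, `∑ t_a a` is a convex combination of the points `k • a`, while the nonnegative
remainder is in the hull of the lattice points of the orthant. The hull of a sum of sets is the sum
of the hulls. -/
theorem mem_closedLatticeSet_iff {k : ℕ} {v : Fin n →₀ ℕ} :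
    v ∈ closedLatticeSet A k ↔ toReal v ∈ newtonPolyhedron A k := by
  classical
  constructor
  · intro hv
    refine convexHull_min ?_ (convex_newtonPolyhedron (k : ℝ)) hv
    rintro _ ⟨u, hu, rfl⟩
    exact toReal_mem_newtonPolyhedron_of_mem_latticeSet hu
  · rintro ⟨t, ht0, ht, htv⟩
    have hsub : toReal '' latticeSet A k + Set.range (toReal (n := n)) ⊆
        toReal '' latticeSet A k := by
      rintro _ ⟨_, ⟨u, hu, rfl⟩, _, ⟨w, rfl⟩, rfl⟩
      exact ⟨u + w, latticeSet_mono hu (self_le_add_right _ _), toReal_add _ _⟩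
    refine convexHull_mono hsub ?_
    rw [convexHull_add]
    refine ⟨fun i => ∑ a ∈ A, t a * (a i : ℝ), ?_, fun i => v i - ∑ a ∈ A, t a * (a i : ℝ),
      mem_convexHull_toReal_of_nonneg fun i => sub_nonneg.2 (htv i), ?_⟩
    · rcases Nat.eq_zero_or_pos k with rfl | hk
      · have h0 : ∀ a ∈ A, t a = 0 :=
          (Finset.sum_eq_zero_iff_of_nonneg fun a _ => ht0 a).1 (by simpa using ht)
        refine subset_convexHull _ _ ⟨0, mem_latticeSet_iff.2 ⟨0, 0, Nat.zero_le _, by simp⟩, ?_⟩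
        funext i
        rw [Finset.sum_eq_zero fun a ha => by rw [h0 a ha, zero_mul]]
        simp [toReal]
      · have hk' : (0 : ℝ) < k := by exact_mod_cast hk
        have h : (fun i => ∑ a ∈ A, t a * (a i : ℝ)) =
            ∑ a ∈ A, (t a / k) • toReal (k • a) := by
          funext i
          simp only [Finset.sum_apply, Pi.smul_apply, smul_eq_mul, toReal, Finsupp.smul_apply,
            Nat.cast_mul]
          exact Finset.sum_congr rfl fun a _ => by field_simp
        rw [h]
        refine (convex_convexHull ℝ _).sum_mem (fun a _ => div_nonneg (ht0 a) hk'.le) ?_ ?_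
        · rw [← Finset.sum_div, ht, div_self hk'.ne']
        · intro a ha
          refine subset_convexHull _ _ ⟨_, mem_latticeSet_iff.2 ⟨Pi.single a k, 0, ?_, ?_⟩, rfl⟩
          · simp [Pi.single_apply, ha]
          · rw [Finset.sum_eq_single_of_mem a ha (fun b _ hab => by simp [hab])]
            simp
    · funext i
      simp [toReal]

theorem closedLatticeSet_mono {k : ℕ} {u v : Fin n →₀ ℕ} (hu : u ∈ closedLatticeSet A k)
    (huv : u ≤ v) : v ∈ closedLatticeSet A k := by
  rw [mem_closedLatticeSet_iff] at hu ⊢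
  exact newtonPolyhedron_mono hu fun i => Nat.cast_le.2 (huv i)

theorem closedLatticeSet_antitone {k l : ℕ} (hlk : l ≤ k) :
    closedLatticeSet A k ⊆ closedLatticeSet A l := by
  intro u hu
  rw [mem_closedLatticeSet_iff] at hu ⊢
  exact newtonPolyhedron_antitone (Nat.cast_nonneg _) (Nat.cast_le.2 hlk) hu

theorem closedLatticeSet_add {k l : ℕ} {u v : Fin n →₀ ℕ} (hu : u ∈ closedLatticeSet A k)
    (hv : v ∈ closedLatticeSet A l) : u + v ∈ closedLatticeSet A (k + l) := by
  rw [mem_closedLatticeSet_iff] at hu hv ⊢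
  rw [toReal_add, Nat.cast_add]
  exact newtonPolyhedron_add hu hv

theorem latticeSet_subset_closedLatticeSet (k : ℕ) : latticeSet A k ⊆ closedLatticeSet A k :=
  fun _ hv => mem_closedLatticeSet_iff.2 (toReal_mem_newtonPolyhedron_of_mem_latticeSet hv)

theorem sum_smul_mem_closedLatticeSet (κ : (Fin n →₀ ℕ) → ℕ) (h : Fin n →₀ ℕ) :
    ∑ a ∈ A, κ a • a + h ∈ closedLatticeSet A (∑ a ∈ A, κ a) :=
  latticeSet_subset_closedLatticeSet _ (mem_latticeSet_iff.2 ⟨κ, h, le_rfl, rfl⟩)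

theorem smul_mem_closedLatticeSet {a : Fin n →₀ ℕ} (ha : a ∈ A) (k : ℕ) :
    k • a ∈ closedLatticeSet A k := by
  classical
  refine latticeSet_subset_closedLatticeSet _ (mem_latticeSet_iff.2 ⟨Pi.single a k, 0, ?_, ?_⟩)
  · simp [Pi.single_apply, ha]
  · rw [Finset.sum_eq_single_of_mem a ha (fun b _ hab => by simp [hab])]
    simp

theorem mem_closedLatticeSet_one {a : Fin n →₀ ℕ} (ha : a ∈ A) : a ∈ closedLatticeSet A 1 := by
  simpa using smul_mem_closedLatticeSet ha 1

theorem mem_closedLatticeSet_zero (v : Fin n →₀ ℕ) : v ∈ closedLatticeSet A 0 :=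
  latticeSet_subset_closedLatticeSet _ (mem_latticeSet_iff.2 ⟨0, v, Nat.zero_le _, by simp⟩)

/-- A lattice point outside the `k`-th dilate of the Newton polyhedron is separated from it by a
weight whose minimum on it is attained at a point of `A`. -/
theorem exists_weight_of_notMem_closedLatticeSet (hA : A.Nonempty) {k : ℕ} {v : Fin n →₀ ℕ}
    (hv : v ∉ closedLatticeSet A k) :
    ∃ w : Fin n → ℝ, ∃ a₀ ∈ A,
      (∀ l : ℕ, ∀ u ∈ closedLatticeSet A l, l * ∑ i, w i * a₀ i ≤ ∑ i, w i * u i) ∧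
      ∑ i, w i * v i < k * ∑ i, w i * a₀ i := by
  classical
  rw [mem_closedLatticeSet_iff] at hv
  obtain ⟨f, s, hfv, hfs⟩ := geometric_hahn_banach_point_closed
    (convex_newtonPolyhedron (A := A) (k : ℝ)) (isClosed_newtonPolyhedron (k : ℝ)) hv
  have hf : ∀ x : Fin n → ℝ, f x = ∑ i, f (Pi.single i 1) * x i := by
    intro x
    conv_lhs => rw [← Finset.univ_sum_single x]
    rw [map_sum]
    refine Finset.sum_congr rfl fun i _ => ?_
    rw [mul_comm, ← smul_eq_mul, ← map_smul, ← Pi.single_smul, smul_eq_mul, mul_one]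
  have hmem : ∀ a ∈ A, toReal (k • a) ∈ newtonPolyhedron A k := fun a ha =>
    mem_closedLatticeSet_iff.1 (smul_mem_closedLatticeSet ha k)
  have hw : ∀ i, 0 ≤ f (Pi.single i 1) := by
    intro i
    by_contra! hi
    obtain ⟨a, ha⟩ := hA
    -- The polyhedron is closed upwards, so a negative weight would drive `f` below `s` far out in
    -- direction `i`.
    obtain ⟨N, hN⟩ := exists_nat_gt ((f (toReal (k • a)) - s) / -f (Pi.single i 1))
    have h1 := hfs (toReal (k • a) + (N : ℝ) • Pi.single i 1) (newtonPolyhedron_mono (hmem a ha) (by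
      rw [le_add_iff_nonneg_right]
      intro j
      by_cases hj : j = i
      · subst hj
        simp
      · simp [hj]))
    rw [map_add, map_smul, smul_eq_mul] at h1
    rw [div_lt_iff₀ (by linarith)] at hN
    linarith
  obtain ⟨a₀, ha₀, hmin⟩ := A.exists_min_image (fun a => ∑ i, f (Pi.single i 1) * (a i : ℝ)) hA
  refine ⟨fun i => f (Pi.single i 1), a₀, ha₀, ?_, ?_⟩
  · intro l u hu
    obtain ⟨t, ht0, ht, htu⟩ := mem_closedLatticeSet_iff.1 hu
    calc (l : ℝ) * ∑ i, f (Pi.single i 1) * (a₀ i : ℝ)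
        = ∑ a ∈ A, t a * ∑ i, f (Pi.single i 1) * (a₀ i : ℝ) := by rw [← Finset.sum_mul, ht]
      _ ≤ ∑ a ∈ A, t a * ∑ i, f (Pi.single i 1) * (a i : ℝ) :=
          Finset.sum_le_sum fun a ha => mul_le_mul_of_nonneg_left (hmin a ha) (ht0 a)
      _ = ∑ i, f (Pi.single i 1) * ∑ a ∈ A, t a * (a i : ℝ) := by
          simp only [Finset.mul_sum]
          rw [Finset.sum_comm]
          exact Finset.sum_congr rfl fun i _ => Finset.sum_congr rfl fun a _ => by ring
      _ ≤ ∑ i, f (Pi.single i 1) * (u i : ℝ) :=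
          Finset.sum_le_sum fun i _ => mul_le_mul_of_nonneg_left (htu i) (hw i)
  · have h1 := hfv.trans (hfs _ (hmem a₀ ha₀))
    rw [hf, hf] at h1
    simp only [toReal, Finsupp.smul_apply, smul_eq_mul, Nat.cast_mul, mul_left_comm _ (k : ℝ),
      ← Finset.mul_sum] at h1
    exact h1

/-- A weight separating `v` from level `k` attains its minimum on `A` at some `a₀`; the hypothesis
at `a₀` alone contradicts the separation. Ideal-theoretically, this is cancellation of `I(A)` in the
colon of consecutive closures. -/
theorem mem_closedLatticeSet_of_forall_add (hA : A.Nonempty) {k : ℕ} {v : Fin n →₀ ℕ}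
    (hv : ∀ a ∈ A, v + a ∈ closedLatticeSet A (k + 1)) : v ∈ closedLatticeSet A k := by
  by_contra hvk
  obtain ⟨w, a₀, ha₀, hl, hlt⟩ := exists_weight_of_notMem_closedLatticeSet hA hvk
  have h1 := hl _ _ (hv a₀ ha₀)
  simp only [Finsupp.add_apply, Nat.cast_add, mul_add, Finset.sum_add_distrib, Nat.cast_one,
    add_mul, one_mul] at h1
  linarith

/-! ### Integral decompositions and Dickson's lemma -/

/-- Rounding the real coefficients down costs at most one per point of `A`. -/
theorem exists_eq_sum_smul_add {k : ℕ} {v : Fin n →₀ ℕ} (hv : v ∈ closedLatticeSet A k) :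
    ∃ (κ : (Fin n →₀ ℕ) → ℕ) (h : Fin n →₀ ℕ), v = ∑ a ∈ A, κ a • a + h ∧
      ∑ a ∈ A, κ a ≤ k ∧ k ≤ ∑ a ∈ A, κ a + A.card := by
  obtain ⟨t, ht0, ht, htv⟩ := mem_closedLatticeSet_iff.1 hv
  have hle : ∑ a ∈ A, ⌊t a⌋₊ • a ≤ v := by
    intro i
    have : toReal (∑ a ∈ A, ⌊t a⌋₊ • a) i ≤ toReal v i := by
      rw [toReal_sum_smul_apply]
      refine le_trans (Finset.sum_le_sum fun a _ => ?_) (htv i)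
      exact mul_le_mul_of_nonneg_right (Nat.floor_le (ht0 a)) (Nat.cast_nonneg _)
    exact Nat.cast_le.1 this
  refine ⟨fun a => ⌊t a⌋₊, v - ∑ a ∈ A, ⌊t a⌋₊ • a, (add_tsub_cancel_of_le hle).symm, ?_, ?_⟩
  · rw [← Nat.cast_le (α := ℝ), Nat.cast_sum, ← ht]
    exact Finset.sum_le_sum fun a _ => Nat.floor_le (ht0 a)
  · rw [← Nat.cast_le (α := ℝ), Nat.cast_add, Nat.cast_sum, ← ht, Finset.card_eq_sum_ones,
      Nat.cast_sum, ← Finset.sum_add_distrib]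
    exact Finset.sum_le_sum fun a _ => by simpa using (Nat.lt_floor_add_one (t a)).le

theorem exists_monotone_subseq_pi_nat {α : Type*} [Finite α] (u : ℕ → α → ℕ) :
    ∃ g : ℕ ↪o ℕ, Monotone (u ∘ g) := by
  obtain ⟨g, hg⟩ := (wellQuasiOrdered_le (α := α → ℕ)).exists_monotone_subseq u
  exact ⟨g, fun i j hij => hg i j hij⟩

/-- Dickson's lemma for the decompositions of `exists_eq_sum_smul_add`. -/
theorem exists_strictMono_decomposition (v : ℕ → Fin n →₀ ℕ) (k : ℕ → ℕ)
    (κ : ℕ → (Fin n →₀ ℕ) → ℕ) (h : ℕ → Fin n →₀ ℕ)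
    (hv : ∀ j, v j = ∑ a ∈ A, κ j a • a + h j)
    (hk : ∀ j, k j ≤ ∑ a ∈ A, κ j a + A.card) :
    ∃ g : ℕ → ℕ, StrictMono g ∧ ∀ i j, i ≤ j → ∃ (κ' : (Fin n →₀ ℕ) → ℕ) (h' : Fin n →₀ ℕ),
      (∀ a ∈ A, κ (g j) a = κ (g i) a + κ' a) ∧ v (g j) = v (g i) + (∑ a ∈ A, κ' a • a + h') ∧
      k (g j) ≤ k (g i) + ∑ a ∈ A, κ' a := by
  -- The last coordinate is the surplus of `∑ κ` over `k`, shifted by `A.card` to be a natural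
  -- number. Its monotonicity gives the final inequality.
  let u : ℕ → (A ⊕ Fin n) ⊕ Unit → ℕ := fun j => Sum.elim
    (Sum.elim (fun a => κ j a) (fun i => h j i)) (fun _ => A.card + ∑ a ∈ A, κ j a - k j)
  obtain ⟨g, hg⟩ := exists_monotone_subseq_pi_nat u
  refine ⟨g, g.strictMono, fun i j hij => ?_⟩
  have hm := hg hij
  have hκ : ∀ a ∈ A, κ (g i) a ≤ κ (g j) a := fun a ha => hm (.inl (.inl ⟨a, ha⟩))
  have hh : h (g i) ≤ h (g j) := fun l => hm (.inl (.inr l))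
  have hd : A.card + ∑ a ∈ A, κ (g i) a - k (g i) ≤ A.card + ∑ a ∈ A, κ (g j) a - k (g j) :=
    hm (.inr ())
  have hsum : ∑ a ∈ A, κ (g j) a = ∑ a ∈ A, κ (g i) a + ∑ a ∈ A, (κ (g j) a - κ (g i) a) := by
    rw [← Finset.sum_add_distrib]
    exact Finset.sum_congr rfl fun a ha => (Nat.add_sub_of_le (hκ a ha)).symm
  refine ⟨fun a => κ (g j) a - κ (g i) a, h (g j) - h (g i),
    fun a ha => (Nat.add_sub_of_le (hκ a ha)).symm, ?_, ?_⟩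
  · rw [hv, hv]
    have : ∑ a ∈ A, κ (g j) a • a =
        ∑ a ∈ A, κ (g i) a • a + ∑ a ∈ A, (κ (g j) a - κ (g i) a) • a := by
      rw [← Finset.sum_add_distrib]
      refine Finset.sum_congr rfl fun a ha => ?_
      rw [← add_smul, Nat.add_sub_of_le (hκ a ha)]
    rw [this]
    nth_rewrite 1 [← add_tsub_cancel_of_le hh]
    exact add_add_add_comm _ _ _ _
  · have h1 := hk (g i)
    have h2 := hk (g j)
    dsimp only
    omega

/-- All multiples of `v` have decompositions of bounded deficit. Dickson's lemma finds two whose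
difference, again a multiple of `v`, has no deficit. -/
theorem exists_smul_mem_latticeSet {k : ℕ} {v : Fin n →₀ ℕ} (hv : v ∈ closedLatticeSet A k) :
    ∃ m : ℕ, 0 < m ∧ m • v ∈ latticeSet A (m * k) := by
  have hmul : ∀ l : ℕ, l • v ∈ closedLatticeSet A (l * k) := by
    intro l
    induction l with
    | zero =>
      rw [zero_mul]
      exact mem_closedLatticeSet_zero _
    | succ l ih =>
      rw [succ_nsmul, Nat.succ_mul]
      exact closedLatticeSet_add ih hv
  choose κ h hv' _ hk using fun l => exists_eq_sum_smul_add (hmul l)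
  obtain ⟨g, hg, hdec⟩ := exists_strictMono_decomposition _ _ κ h hv' hk
  obtain ⟨κ', h', -, hval, hkk⟩ := hdec 0 1 zero_le_one
  have hlt : g 0 < g 1 := hg zero_lt_one
  refine ⟨g 1 - g 0, Nat.sub_pos_of_lt hlt, mem_latticeSet_iff.2 ⟨κ', h', ?_, ?_⟩⟩
  · rw [Nat.sub_mul]
    omega
  · have : g 1 • v = g 0 • v + (g 1 - g 0) • v := by
      rw [← add_smul, Nat.add_sub_of_le hlt.le]
    rw [this] at hval
    exact add_left_cancel hval

end Convexity

/-! ### Solutions and their rays -/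

section Solutions

variable {n : ℕ} {A B : Finset (Fin n →₀ ℕ)}

/-- This is primality of `I(B)` at the level of exponents: the complement consists of the exponents
vanishing at the indices of `B`. -/
theorem add_notMem_latticeSet_one (hBe : ∀ b ∈ B, ∃ i : Fin n, b = Finsupp.single i 1)
    {u v : Fin n →₀ ℕ} (hu : u ∉ latticeSet B 1) (hv : v ∉ latticeSet B 1) :
    u + v ∉ latticeSet B 1 := by
  rw [mem_latticeSet_one] at *
  push Not at *
  intro b hb hle
  obtain ⟨i, rfl⟩ := hBe b hb
  have h1 := hu _ hb
  have h2 := hv _ hb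
  rw [Finsupp.single_le_iff] at h1 h2 hle
  rw [Finsupp.add_apply] at hle
  omega

theorem sum_notMem_latticeSet_one (hBe : ∀ b ∈ B, ∃ i : Fin n, b = Finsupp.single i 1)
    {ι : Type*} (s : Finset ι) (d : ι → Fin n →₀ ℕ) (hd : ∀ i ∈ s, d i ∉ latticeSet B 1) :
    ∑ i ∈ s, d i ∉ latticeSet B 1 := by
  refine Finset.sum_induction d (· ∉ latticeSet B 1)
    (fun _ _ => add_notMem_latticeSet_one hBe) ?_ hd
  rw [mem_latticeSet_one]
  rintro ⟨b, hb, hle⟩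
  obtain ⟨i, rfl⟩ := hBe b hb
  rw [Finsupp.single_le_iff] at hle
  simp at hle

theorem not_isSolution_zero (hBe : ∀ b ∈ B, ∃ i : Fin n, b = Finsupp.single i 1)
    (c : Fin n →₀ ℕ) : ¬ IsSolution A B 0 c := fun h =>
  sum_notMem_latticeSet_one hBe (∅ : Finset ℕ) (fun _ => 0) (by simp)
    ((h _).1 (mem_closedLatticeSet_zero _))

/-- If every `c + a` failed, each would have a witness `d a` outside `latticeSet B 1`. Their sum is
also outside and works for all `a` at once, so cancellation puts `c + ∑ d a` at level `k`, against
`c` being a solution. -/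
theorem IsSolution.exists_add (hA : A.Nonempty)
    (hBe : ∀ b ∈ B, ∃ i : Fin n, b = Finsupp.single i 1) {k : ℕ} {c : Fin n →₀ ℕ}
    (hc : IsSolution A B k c) : ∃ a ∈ A, IsSolution A B (k + 1) (c + a) := by
  by_contra! h
  have hd : ∀ a ∈ A, ∃ d, c + a + d ∈ closedLatticeSet A (k + 1) ∧ d ∉ latticeSet B 1 := by
    intro a ha
    have h1 := h a ha
    unfold IsSolution at h1
    push Not at h1
    obtain ⟨d, h2 | h2⟩ := h1
    · exact ⟨d, h2⟩
    · refine absurd ?_ h2.1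
      rw [add_right_comm]
      exact closedLatticeSet_add ((hc d).2 h2.2) (mem_closedLatticeSet_one ha)
  choose! d hdmem hdB using hd
  refine sum_notMem_latticeSet_one hBe A d hdB ((hc _).1 ?_)
  refine mem_closedLatticeSet_of_forall_add hA fun a ha => ?_
  rw [add_right_comm]
  exact closedLatticeSet_mono (hdmem a ha)
    (add_le_add_right (Finset.single_le_sum (fun _ _ => zero_le) ha) _)

/-- The colons increase from `c` through `c + u` to `c + u + v`, and the outer two are equal. -/
theorem IsSolution.of_add_add {k l l' : ℕ} {c u v : Fin n →₀ ℕ} (hc : IsSolution A B k c)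
    (hu : u ∈ closedLatticeSet A l) (hv : v ∈ closedLatticeSet A l')
    (h : IsSolution A B (k + l + l') (c + u + v)) : IsSolution A B (k + l) (c + u) := by
  intro d
  constructor
  · intro hd
    refine (h d).1 ?_
    rw [add_right_comm (c + u)]
    exact closedLatticeSet_add hd hv
  · intro hd
    rw [add_right_comm]
    exact closedLatticeSet_add ((hc d).2 hd) hu

theorem exists_sum_eq_add_sum {κ : (Fin n →₀ ℕ) → ℕ} {a : Fin n →₀ ℕ} (ha : a ∈ A) {l : ℕ}
    (hl : l ≤ κ a) : ∃ κ' : (Fin n →₀ ℕ) → ℕ, ∑ b ∈ A, κ b = l + ∑ b ∈ A, κ' b ∧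
      ∑ b ∈ A, κ b • b = l • a + ∑ b ∈ A, κ' b • b := by
  classical
  refine ⟨Function.update κ a (κ a - l), ?_, ?_⟩
  · rw [← Finset.add_sum_erase _ _ ha, ← Finset.add_sum_erase _ _ ha, Function.update_self,
      ← add_assoc, Nat.add_sub_of_le hl]
    exact congrArg _ (Finset.sum_congr rfl fun b hb => by
      rw [Function.update_of_ne (Finset.ne_of_mem_erase hb)])
  · rw [← Finset.add_sum_erase _ _ ha, ← Finset.add_sum_erase _ _ ha, Function.update_self,
      ← add_assoc, ← add_smul, Nat.add_sub_of_le hl]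
    exact congrArg _ (Finset.sum_congr rfl fun b hb => by
      rw [Function.update_of_ne (Finset.ne_of_mem_erase hb)])

/-- `a` is a direction along which `c` can be moved without ceasing to be a solution. -/
def IsRay (A B : Finset (Fin n →₀ ℕ)) (k : ℕ) (c a : Fin n →₀ ℕ) : Prop :=
  ∀ j : ℕ, IsSolution A B (k + j) (c + j • a)

theorem IsSolution.exists_isRay (hA : A.Nonempty)
    (hBe : ∀ b ∈ B, ∃ i : Fin n, b = Finsupp.single i 1) {k : ℕ} {c : Fin n →₀ ℕ}
    (hc : IsSolution A B k c) : ∃ a ∈ A, IsRay A B k c a := by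
  classical
  have hpath : ∀ N : ℕ, ∃ κ : (Fin n →₀ ℕ) → ℕ, ∑ a ∈ A, κ a = N ∧
      IsSolution A B (k + N) (c + ∑ a ∈ A, κ a • a) := by
    intro N
    induction N with
    | zero => exact ⟨0, by simp, by simpa using hc⟩
    | succ N ih =>
      obtain ⟨κ, hκ, hs⟩ := ih
      obtain ⟨a, ha, h⟩ := hs.exists_add hA hBe
      refine ⟨κ + Pi.single a 1, ?_, ?_⟩
      · simp only [Pi.add_apply, Finset.sum_add_distrib, hκ]
        simp [Pi.single_apply, ha]
      · have : ∑ b ∈ A, (Pi.single a 1 : (Fin n →₀ ℕ) → ℕ) b • b = a := by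
          rw [Finset.sum_eq_single_of_mem a ha (fun b _ hab => by simp [hab])]
          simp
        simp only [Pi.add_apply, add_smul, Finset.sum_add_distrib, this]
        rwa [← add_assoc, ← add_assoc]
  by_contra! h
  have hj : ∀ a ∈ A, ∃ j : ℕ, ¬ IsSolution A B (k + j) (c + j • a) := fun a ha => by
    simpa [IsRay] using h a ha
  choose! j hj using hj
  -- On a path this long some `a` is used more than `j a` times. The order of the steps is
  -- immaterial, so those of `a` may come first, and sandwiching makes `c + j a • a` a solution.
  obtain ⟨κ, hκ, hs⟩ := hpath (∑ a ∈ A, j a + 1)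
  obtain ⟨a, ha, hlt⟩ := Finset.exists_lt_of_sum_lt (s := A) (f := j) (g := κ) (by omega)
  obtain ⟨κ', h1, h2⟩ := exists_sum_eq_add_sum ha hlt.le
  refine hj a ha (hc.of_add_add (smul_mem_closedLatticeSet ha _)
    (sum_smul_mem_closedLatticeSet κ' 0) ?_)
  rw [add_zero, add_assoc, add_assoc, ← h1, ← h2, hκ]
  exact hs

theorem IsRay.add {k : ℕ} {c a : Fin n →₀ ℕ} (h : IsRay A B k c a) :
    IsRay A B (k + 1) (c + a) a := by
  intro j
  have := h (j + 1)
  rwa [succ_nsmul', ← add_assoc c, show k + (j + 1) = k + 1 + j by omega] at this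

theorem IsRay.isSolution {k : ℕ} {c a : Fin n →₀ ℕ} (h : IsRay A B k c a) :
    IsSolution A B k c := by
  simpa using h 0

/-- Moving a solution along `a` thus creates no new rays, so a ray of least degree remains one of
least degree. -/
theorem IsRay.of_add {k : ℕ} {c a b : Fin n →₀ ℕ} (ha : a ∈ A) (hb : b ∈ A)
    (hc : IsSolution A B k c) (h : IsRay A B (k + 1) (c + a) b) : IsRay A B k c b := by
  intro j
  refine hc.of_add_add (smul_mem_closedLatticeSet hb j) (mem_closedLatticeSet_one ha) ?_
  have := h j
  rwa [add_right_comm c, add_right_comm k] at this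

/-! ### The modulus of optimal solutions -/

/-- A point of `A` that occurs often enough in a decomposition of a translated solution is a
direction of that solution. -/
theorem exists_bound_isRay_of_le {b₀ b : Fin n →₀ ℕ} (hb : b ∈ A) :
    ∃ C : ℕ, ∀ (k : ℕ) (c : Fin n →₀ ℕ) (κ : (Fin n →₀ ℕ) → ℕ) (h : Fin n →₀ ℕ),
      IsSolution A B k c → c + b₀ = ∑ a ∈ A, κ a • a + h → ∑ a ∈ A, κ a ≤ k →
      k ≤ ∑ a ∈ A, κ a + A.card → C ≤ κ b → IsRay A B k c b := by
  by_contra! hcon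
  choose k c κ h hc hdec hκk hkκ hCκ hray using hcon
  obtain ⟨g, hg, hmono⟩ := exists_strictMono_decomposition (fun j => c j + b₀) k κ h hdec hkκ
  have hray0 := hray (g 0)
  unfold IsRay at hray0
  push Not at hray0
  obtain ⟨l, hl⟩ := hray0
  -- This index makes the increment `κ' b` at least `l` and `k (g j)` at least `k (g 0) + l`, so `l
  -- • b` can be split off between the solutions `c (g 0)` and `c (g j)`.
  set j := κ (g 0) b + l + k (g 0) with hj
  obtain ⟨κ', h', hκ', hval, hkk⟩ := hmono 0 j (Nat.zero_le _)
  have hbig : j ≤ κ (g j) b := (hg.le_apply).trans (hCκ (g j))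
  have hbsum : κ (g j) b ≤ ∑ a ∈ A, κ (g j) a :=
    Finset.single_le_sum (f := κ (g j)) (fun _ _ => Nat.zero_le _) hb
  have hkj := hκk (g j)
  have hκb := hκ' b hb
  obtain ⟨κ'', h1, h2⟩ := exists_sum_eq_add_sum (κ := κ') hb (l := l) (by omega)
  apply hl
  refine (hc (g 0)).of_add_add (l' := k (g j) - k (g 0) - l) (smul_mem_closedLatticeSet hb l)
    (closedLatticeSet_antitone ?_ (sum_smul_mem_closedLatticeSet κ'' h')) ?_
  · omega
  · have hcj : c (g j) = c (g 0) + l • b + (∑ a ∈ A, κ'' a • a + h') := by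
      refine add_right_cancel (b := b₀) ?_
      rw [hval, h2]
      abel
    rw [← hcj, show k (g 0) + l + (k (g j) - k (g 0) - l) = k (g j) by omega]
    exact hc (g j)

theorem exists_bound_degree (hB : B.Nonempty) :
    ∃ C : ℕ, ∀ (k : ℕ) (c a : Fin n →₀ ℕ), IsSolution A B k c → a ∈ A →
      (∀ b ∈ A, IsRay A B k c b → a.degree ≤ b.degree) → a.degree * k ≤ c.degree + C := by
  obtain ⟨b₀, hb₀⟩ := hB
  have hC : ∀ b ∈ A, _ := fun b hb => exists_bound_isRay_of_le (A := A) (B := B) (b₀ := b₀) hb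
  choose! C₀ hC₀ using hC
  set C := ∑ b ∈ A, C₀ b with hCdef
  set D := ∑ b ∈ A, b.degree with hD
  refine ⟨b₀.degree + D * (A.card * C + A.card), fun k c a hc ha hmin => ?_⟩
  -- A solution itself is not at level `k`, so it is translated by a point of `B` before being
  -- decomposed.
  have hmem : c + b₀ ∈ closedLatticeSet A k := (hc b₀).2 (mem_latticeSet_one.2 ⟨b₀, hb₀, le_rfl⟩)
  obtain ⟨κ, h, hdec, hκk, hkκ⟩ := exists_eq_sum_smul_add hmem
  have haD : a.degree ≤ D := Finset.single_le_sum (f := fun b : Fin n →₀ ℕ => b.degree)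
    (fun _ _ => Nat.zero_le _) ha
  -- If `κ b` is large, `b` is a ray and has degree at least that of `a`; otherwise the left side is
  -- at most `D * C`.
  have hpt : ∀ b ∈ A, a.degree * κ b ≤ κ b * b.degree + D * C := by
    intro b hb
    have hbC : C₀ b ≤ C := Finset.single_le_sum (f := C₀) (fun _ _ => Nat.zero_le _) hb
    rcases le_or_gt (C₀ b) (κ b) with hle | hlt
    · have := hmin b hb (hC₀ b hb k c κ h hc hdec hκk hkκ hle)
      rw [mul_comm]
      exact (Nat.mul_le_mul_left _ this).trans (Nat.le_add_right _ _)
    · exact (Nat.mul_le_mul haD (by omega)).trans (Nat.le_add_left _ _)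
  have hsum := Finset.sum_le_sum hpt
  rw [← Finset.mul_sum, Finset.sum_add_distrib, Finset.sum_const, smul_eq_mul] at hsum
  have hdeg : c.degree + b₀.degree = ∑ b ∈ A, κ b * b.degree + h.degree := by
    have := congrArg Finsupp.degree hdec
    simpa [map_add, map_sum, map_nsmul] using this
  calc a.degree * k ≤ a.degree * (∑ b ∈ A, κ b) + a.degree * A.card := by
        rw [← mul_add]
        exact Nat.mul_le_mul_left _ hkκ
    _ ≤ (∑ b ∈ A, κ b * b.degree + A.card * (D * C)) + D * A.card :=
        add_le_add hsum (Nat.mul_le_mul_right _ haD)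
    _ ≤ (c.degree + b₀.degree + A.card * (D * C)) + D * A.card := by omega
    _ = c.degree + (b₀.degree + D * (A.card * C + A.card)) := by ring

/-- The minimum of a family of sets of natural numbers that are stable under translation by
constant slopes, and bounded below by a linear function of that slope, is eventually linear. -/
theorem eventually_sInf_eq_linear {ι : Type*} [Finite ι] (D : ι → ℕ) (V : ι → ℕ → Set ℕ) (C : ℕ)
    (hadd : ∀ i k, ∀ x ∈ V i k, x + D i ∈ V i (k + 1))
    (hle : ∀ i k, ∀ x ∈ V i k, D i * k ≤ x + C)
    (hne : ∀ᶠ k in atTop, (⋃ i, V i k).Nonempty) :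
    ∃ α β : ℤ, ∀ᶠ k : ℕ in atTop, ((sInf (⋃ i, V i k) : ℕ) : ℤ) = α * k + β := by
  obtain ⟨K, hK⟩ := eventually_atTop.1 hne
  have hex : ∃ d, ∃ i k x, x ∈ V i k ∧ D i = d := by
    obtain ⟨x, hx⟩ := hK K le_rfl
    obtain ⟨i, hi⟩ := Set.mem_iUnion.1 hx
    exact ⟨_, i, K, x, hi, rfl⟩
  classical
  obtain ⟨i₀, k₀, x₀, hx₀, hi₀⟩ := Nat.find_spec hex
  have hmin : ∀ i k x, x ∈ V i k → D i₀ ≤ D i := fun i k x hx =>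
    hi₀ ▸ Nat.find_min' hex ⟨i, k, x, hx, rfl⟩
  set f : ℕ → ℕ := fun k => sInf (⋃ i, V i k) with hf
  have hupper : ∀ j, x₀ + D i₀ * j ∈ V i₀ (k₀ + j) := by
    intro j
    induction j with
    | zero => simpa using hx₀
    | succ j ih =>
      rw [Nat.mul_succ, ← add_assoc, ← add_assoc]
      exact hadd _ _ _ ih
  have hfle : ∀ k, k₀ ≤ k → f k ≤ x₀ + D i₀ * k := by
    intro k hk
    have h1 := hupper (k - k₀)
    rw [Nat.add_sub_of_le hk] at h1
    exact (Nat.sInf_le (Set.mem_iUnion.2 ⟨i₀, h1⟩)).trans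
      (Nat.add_le_add_left (Nat.mul_le_mul_left _ (Nat.sub_le _ _)) _)
  -- Once `k > x₀ + C`, a minimum attained on a slope above `D i₀` would exceed the upper bound `x₀
  -- + D i₀ * k`.
  set M := max K (max k₀ (x₀ + C + 1)) with hM
  have hstep : ∀ k, M ≤ k → f (k + 1) ≤ f k + D i₀ ∧ D i₀ * k ≤ f k + C := by
    intro k hk
    obtain ⟨i, hi⟩ := Set.mem_iUnion.1 (Nat.sInf_mem (hK k (by omega)))
    have h1 := hle i k _ hi
    have h2 := hfle k (by omega)
    have h3 : D i = D i₀ := by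
      refine le_antisymm ?_ (hmin i k _ hi)
      by_contra! hlt
      have h4 : (D i₀ + 1) * k ≤ D i * k := Nat.mul_le_mul_right _ hlt
      rw [add_mul, one_mul] at h4
      change D i * k ≤ f k + C at h1
      omega
    rw [← h3]
    exact ⟨Nat.sInf_le (Set.mem_iUnion.2 ⟨i, hadd i k _ hi⟩), h1⟩
  -- After removal of the slope, a decreasing sequence of natural numbers remains, hence an
  -- eventually constant one.
  set g : ℕ → ℕ := fun j => f (M + j) + C - D i₀ * (M + j) with hg
  have hganti : Antitone g := by
    refine antitone_nat_of_succ_le fun j => ?_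
    have h1 := (hstep (M + j) (by omega)).1
    simp only [hg, ← add_assoc, Nat.mul_succ]
    omega
  obtain ⟨N, hN⟩ := WellFoundedLT.antitone_chain_condition hganti
  refine ⟨D i₀, g N - C, ?_⟩
  filter_upwards [eventually_ge_atTop (M + N)] with k hk
  have h1 : g N = g (k - M) := hN (k - M) (by omega)
  have h2 := (hstep k (by omega)).2
  rw [h1]
  simp only [hg, Nat.add_sub_of_le (show M ≤ k by omega)]
  push_cast [Nat.cast_sub h2]
  ring

theorem exists_isEventuallyQuasiLinear_degree (hA : A.Nonempty) (hB : B.Nonempty)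
    (hBe : ∀ b ∈ B, ∃ i : Fin n, b = Finsupp.single i 1)
    (hsol : ∀ᶠ k : ℕ in atTop, ∃ c : Fin n →₀ ℕ, IsSolution A B k c) :
    ∃ f : ℕ → ℕ, IsEventuallyQuasiLinear f ∧
      ∀ᶠ k : ℕ in atTop, (∃ c, IsOptimalSolution A B k c) ∧
        ∀ c, IsOptimalSolution A B k c → c.degree = f k := by
  let V : A → ℕ → Set ℕ := fun a k => {x | ∃ c, c.degree = x ∧ IsRay A B k c a ∧
    ∀ b ∈ A, IsRay A B k c b → (a : Fin n →₀ ℕ).degree ≤ b.degree}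
  have hV : ∀ k x, x ∈ ⋃ a, V a k ↔ ∃ c, IsSolution A B k c ∧ c.degree = x := by
    intro k x
    rw [Set.mem_iUnion]
    constructor
    · rintro ⟨a, c, hx, hray, -⟩
      exact ⟨c, hray.isSolution, hx⟩
    · rintro ⟨c, hc, hx⟩
      classical
      obtain ⟨a₀, ha₀, hray⟩ := hc.exists_isRay hA hBe
      obtain ⟨a, ha, hmin⟩ := (A.filter fun a => IsRay A B k c a).exists_min_image
        (fun a => a.degree) ⟨a₀, Finset.mem_filter.2 ⟨ha₀, hray⟩⟩
      rw [Finset.mem_filter] at ha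
      exact ⟨⟨a, ha.1⟩, c, hx, ha.2, fun b hb h => hmin b (Finset.mem_filter.2 ⟨hb, h⟩)⟩
  obtain ⟨C, hC⟩ := exists_bound_degree (A := A) hB
  obtain ⟨α, β, h⟩ := eventually_sInf_eq_linear (fun a : A => (a : Fin n →₀ ℕ).degree) V C
    (by
      rintro a k _ ⟨c, rfl, hray, hmin⟩
      refine ⟨c + a, map_add _ _ _, hray.add, fun b hb h => hmin b hb ?_⟩
      exact h.of_add a.2 hb hray.isSolution)
    (by
      rintro a k _ ⟨c, rfl, hray, hmin⟩
      exact hC k c a hray.isSolution a.2 hmin)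
    (by
      filter_upwards [hsol] with k ⟨c, hc⟩
      exact ⟨_, (hV k _).2 ⟨c, hc, rfl⟩⟩)
  refine ⟨fun k => sInf (⋃ a, V a k), ⟨1, one_pos, fun _ => α, fun _ => β, ?_⟩, ?_⟩
  · filter_upwards [h] with k hk _ _
    exact hk
  · filter_upwards [hsol] with k ⟨c₀, hc₀⟩
    obtain ⟨c, hc, hdeg⟩ := (hV k _).1 (Nat.sInf_mem ⟨_, (hV k _).2 ⟨c₀, hc₀, rfl⟩⟩)
    have hmin : ∀ c', IsSolution A B k c' → sInf (⋃ a, V a k) ≤ c'.degree := fun c' hc' =>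
      Nat.sInf_le ((hV k _).2 ⟨c', hc', rfl⟩)
    refine ⟨⟨c, hc, fun c' hc' => hdeg ▸ hmin c' hc'⟩, fun c' hc' => ?_⟩
    exact le_antisymm (hdeg ▸ hc'.2 c hc) (hmin c' hc'.1)

/-! ### Solutions at higher levels and at the first level -/

theorem IsSolution.exists_of_le (hA : A.Nonempty)
    (hBe : ∀ b ∈ B, ∃ i : Fin n, b = Finsupp.single i 1) {k l : ℕ} (hkl : k ≤ l)
    {c : Fin n →₀ ℕ} (hc : IsSolution A B k c) : ∃ c', IsSolution A B l c' := by
  obtain ⟨a, -, h⟩ := hc.exists_isRay hA hBe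
  refine ⟨_, Nat.add_sub_of_le hkl ▸ h (l - k)⟩

/-- If there are solutions, then there is one that lies in the previous member of the
filtration. -/
theorem exists_isSolution_mem (hBe : ∀ b ∈ B, ∃ i : Fin n, b = Finsupp.single i 1)
    (h : ∃ k c, IsSolution A B k c) :
    ∃ m c, IsSolution A B (m + 1) c ∧ c ∈ closedLatticeSet A m := by
  classical
  obtain ⟨c, hc⟩ := Nat.find_spec h
  obtain ⟨m, hm⟩ : ∃ m, Nat.find h = m + 1 := by
    refine Nat.exists_eq_succ_of_ne_zero fun h0 => ?_
    rw [h0] at hc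
    exact not_isSolution_zero hBe c hc
  rw [hm] at hc
  have hmin : ¬ IsSolution A B m c := fun h' => Nat.find_min h (by omega) ⟨c, h'⟩
  unfold IsSolution at hmin
  push Not at hmin
  obtain ⟨d, ⟨hd, hdB⟩ | ⟨hd, hdB⟩⟩ := hmin
  -- Adding a `d` outside `latticeSet B 1` does not change the colon, by primality, and this `d`
  -- moves `c` into level `m`.
  · refine ⟨m, c + d, fun e => ?_, hd⟩
    rw [add_assoc]
    refine (hc _).trans ⟨fun he => ?_, fun he => latticeSet_mono he (self_le_add_left _ _)⟩
    by_contra hcon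
    exact add_notMem_latticeSet_one hBe hdB hcon he
  · exact absurd (closedLatticeSet_antitone m.le_succ ((hc d).2 hdB)) hd

end Solutions

/-! ### Monomial ideals and their powers -/

section MonomialIdeals

variable {K : Type*} [Field K] {n : ℕ} {A B : Finset (Fin n →₀ ℕ)}

theorem mem_monomialIdeal {U : Set (Fin n →₀ ℕ)} {f : MvPolynomial (Fin n) K} :
    f ∈ monomialIdeal K U ↔ ∀ u ∈ f.support, ∃ v ∈ U, v ≤ u :=
  MvPolynomial.mem_ideal_span_monomial_image

theorem mem_monomialIdeal_iff_latticeSet_one {f : MvPolynomial (Fin n) K} :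
    f ∈ monomialIdeal K (B : Set (Fin n →₀ ℕ)) ↔ ∀ u ∈ f.support, u ∈ latticeSet B 1 := by
  rw [mem_monomialIdeal]
  simp only [mem_latticeSet_one, Finset.mem_coe]

theorem monomialIdeal_pow (k : ℕ) :
    monomialIdeal K (A : Set (Fin n →₀ ℕ)) ^ k = monomialIdeal K (latticeSet A k) := by
  apply le_antisymm
  · induction k with
    | zero =>
      intro f _
      rw [mem_monomialIdeal]
      exact fun u _ => ⟨u, mem_latticeSet_iff.2 ⟨0, u, Nat.zero_le _, by simp⟩, le_rfl⟩
    | succ k ih =>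
      rw [pow_succ]
      refine (Ideal.mul_mono_left ih).trans ?_
      unfold monomialIdeal
      rw [Ideal.span_mul_span', Ideal.span_le]
      rintro _ ⟨_, ⟨u, hu, rfl⟩, _, ⟨a, ha, rfl⟩, rfl⟩
      refine Ideal.subset_span ⟨u + a, ?_, ?_⟩
      · exact latticeSet_add hu (mem_latticeSet_one.2 ⟨a, ha, le_rfl⟩)
      · simp [MvPolynomial.monomial_mul]
  · unfold monomialIdeal
    rw [Ideal.span_le]
    rintro _ ⟨u, hu, rfl⟩
    obtain ⟨κ, h, hκ, rfl⟩ := mem_latticeSet_iff.1 hu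
    have h1 : MvPolynomial.monomial (∑ a ∈ A, κ a • a + h) (1 : K) =
        (∏ a ∈ A, MvPolynomial.monomial a (1 : K) ^ κ a) * MvPolynomial.monomial h 1 := by
      rw [← mul_one (1 : K), ← MvPolynomial.monomial_mul, MvPolynomial.monomial_sum_one, mul_one]
      simp [MvPolynomial.monomial_pow]
    simp only [h1, SetLike.mem_coe]
    refine Ideal.mul_mem_right _ _ (Ideal.pow_le_pow_right hκ ?_)
    rw [← Finset.prod_pow_eq_pow_sum]
    exact Ideal.prod_mem_prod fun a ha =>
      Ideal.pow_mem_pow (Ideal.subset_span (Set.mem_image_of_mem _ ha)) _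

/-! ### Monomial valuations and integral closure -/

/-- The substitution `xᵢ ↦ xᵢ t^{wᵢ}` into Hahn series in `t` with real exponents. -/
noncomputable def weightHom (K : Type*) [Field K] {n : ℕ} (w : Fin n → ℝ) :
    MvPolynomial (Fin n) K →+* HahnSeries ℝ (MvPolynomial (Fin n) K) :=
  MvPolynomial.eval₂Hom (HahnSeries.C.comp MvPolynomial.C) fun i =>
    HahnSeries.single (w i) (MvPolynomial.X i)

theorem weightHom_monomial (w : Fin n → ℝ) (u : Fin n →₀ ℕ) (c : K) :
    weightHom K w (MvPolynomial.monomial u c) =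
      HahnSeries.single (∑ i, w i * u i) (MvPolynomial.monomial u c) := by
  have hprod : ∀ s : Finset (Fin n),
      ∏ i ∈ s, HahnSeries.single (w i) (MvPolynomial.X i : MvPolynomial (Fin n) K) ^ u i =
      HahnSeries.single (∑ i ∈ s, w i * u i) (∏ i ∈ s, MvPolynomial.X i ^ u i) := by
    classical
    intro s
    induction s using Finset.induction_on with
    | empty => simp
    | insert i s hi ih =>
      rw [Finset.prod_insert hi, Finset.sum_insert hi, Finset.prod_insert hi, ih,
        HahnSeries.single_pow, HahnSeries.single_mul_single, nsmul_eq_mul, mul_comm (u i : ℝ)]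
  rw [weightHom, MvPolynomial.coe_eval₂Hom, MvPolynomial.eval₂_monomial,
    Finsupp.prod_fintype _ _ (fun _ => pow_zero _), hprod,
    RingHom.comp_apply, HahnSeries.C_apply, HahnSeries.single_mul_single, zero_add,
    ← Finsupp.prod_fintype _ _ (fun _ => pow_zero _),
    ← MvPolynomial.monomial_eq]

/-- The variables are retained in the coefficients, so distinct monomials of equal weight cannot
cancel. -/
theorem coeff_weightHom (w : Fin n → ℝ) (f : MvPolynomial (Fin n) K) (u : Fin n →₀ ℕ) :
    MvPolynomial.coeff u ((weightHom K w f).coeff (∑ i, w i * u i)) = MvPolynomial.coeff u f := by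
  classical
  induction f using MvPolynomial.induction_on' with
  | monomial v c =>
    rw [weightHom_monomial, HahnSeries.coeff_single]
    split_ifs with h
    · rfl
    · rw [MvPolynomial.coeff_zero, MvPolynomial.coeff_monomial, if_neg]
      rintro rfl
      exact h rfl
  | add p q hp hq => rw [map_add, HahnSeries.coeff_add, MvPolynomial.coeff_add, hp, hq,
      MvPolynomial.coeff_add]

/-- The monomial valuation of weight `w`. -/
noncomputable def weightVal (K : Type*) [Field K] {n : ℕ} (w : Fin n → ℝ) :
    AddValuation (MvPolynomial (Fin n) K) (WithTop ℝ) :=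
  (HahnSeries.addVal ℝ (MvPolynomial (Fin n) K)).comap (weightHom K w)

theorem weightVal_le (w : Fin n → ℝ) {f : MvPolynomial (Fin n) K} {u : Fin n →₀ ℕ}
    (hu : u ∈ f.support) : weightVal K w f ≤ (∑ i, w i * u i : ℝ) := by
  refine HahnSeries.addVal_le_of_coeff_ne_zero (x := weightHom K w f) fun h => ?_
  have := coeff_weightHom w f u
  rw [h, MvPolynomial.coeff_zero] at this
  exact MvPolynomial.mem_support_iff.1 hu this.symm

theorem le_weightVal (w : Fin n → ℝ) {f : MvPolynomial (Fin n) K} {γ : ℝ}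
    (h : ∀ u ∈ f.support, γ ≤ ∑ i, w i * u i) : (γ : WithTop ℝ) ≤ weightVal K w f := by
  rw [f.as_sum]
  refine AddValuation.map_le_sum _ fun u hu => ?_
  change _ ≤ HahnSeries.addVal _ _ (weightHom K w _)
  rw [weightHom_monomial, HahnSeries.addVal_apply, HahnSeries.orderTop_single (by
    rwa [Ne, MvPolynomial.monomial_eq_zero, ← Ne, ← MvPolynomial.mem_support_iff])]
  exact WithTop.coe_le_coe.2 (h u hu)

/-- Otherwise a separating weight gives `f` a value below `k * α`, where `α` is the weight of `a₀`.
Then `f ^ m` has strictly smaller value than every other term of the integral equation. -/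
theorem mem_closedLatticeSet_of_isIntegralOverIdeal (hA : A.Nonempty) {k : ℕ}
    {f : MvPolynomial (Fin n) K}
    (hf : IsIntegralOverIdeal (monomialIdeal K (A : Set (Fin n →₀ ℕ)) ^ k) f) {u : Fin n →₀ ℕ}
    (hu : u ∈ f.support) : u ∈ closedLatticeSet A k := by
  by_contra huk
  obtain ⟨w, a₀, -, hw, hlt⟩ := exists_weight_of_notMem_closedLatticeSet hA huk
  set α := ∑ i, w i * (a₀ i : ℝ) with hα
  obtain ⟨m, hm, a, ha, heq⟩ := hf
  have hle := weightVal_le w hu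
  obtain ⟨β, hβ⟩ := WithTop.ne_top_iff_exists.1 (ne_top_of_le_ne_top WithTop.coe_ne_top hle)
  rw [← hβ, WithTop.coe_le_coe] at hle
  have hpow : ∀ j : ℕ, weightVal K w (f ^ j) = ((j * β : ℝ) : WithTop ℝ) := by
    intro j
    rw [AddValuation.map_pow, ← hβ, ← WithTop.coe_nsmul, nsmul_eq_mul]
  have hsum : ((m * β : ℝ) : WithTop ℝ) <
      weightVal K w (∑ i ∈ Finset.Icc 1 m, a i * f ^ (m - i)) := by
    refine AddValuation.map_lt_sum' _ (WithTop.coe_lt_top _) fun i hi => ?_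
    have hai := ha i hi
    rw [← pow_mul, monomialIdeal_pow, mem_monomialIdeal] at hai
    have h1 : ((((k * i : ℕ) : ℝ) * α : ℝ) : WithTop ℝ) ≤ weightVal K w (a i) := by
      refine le_weightVal w fun v hv => ?_
      obtain ⟨v', hv', hle'⟩ := hai v hv
      exact hw _ _ (latticeSet_subset_closedLatticeSet _ (latticeSet_mono hv' hle'))
    rw [AddValuation.map_mul, hpow]
    refine lt_of_lt_of_le ?_ (add_le_add_left h1 _)
    rw [← WithTop.coe_add, WithTop.coe_lt_coe]
    rw [Finset.mem_Icc] at hi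
    have hi1 : (1 : ℝ) ≤ i := by exact_mod_cast hi.1
    rw [Nat.cast_sub hi.2]
    push_cast
    nlinarith
  have hneg : f ^ m = -∑ i ∈ Finset.Icc 1 m, a i * f ^ (m - i) := eq_neg_of_add_eq_zero_left heq
  rw [← AddValuation.map_neg, ← hneg, hpow] at hsum
  exact lt_irrefl _ hsum

theorem mem_closurePowers (hA : A.Nonempty) {k : ℕ} {f : MvPolynomial (Fin n) K} :
    f ∈ (closurePowers (monomialIdeal K (A : Set (Fin n →₀ ℕ)))).toFun k ↔
      ∀ u ∈ f.support, u ∈ closedLatticeSet A k := by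
  refine ⟨fun hf u => mem_closedLatticeSet_of_isIntegralOverIdeal hA hf, fun hf => ?_⟩
  rw [f.as_sum]
  refine Ideal.sum_mem _ fun u hu => ?_
  rw [← mul_one (MvPolynomial.coeff u f), ← MvPolynomial.C_mul_monomial]
  refine Ideal.mul_mem_left _ _ ?_
  obtain ⟨m, hm, hmu⟩ := exists_smul_mem_latticeSet (hf u hu)
  -- The equation is `T ^ m - x^(m • u) = 0`, whose constant term lies in the right power.
  refine ⟨m, hm, fun i => if i = m then -(MvPolynomial.monomial (m • u) 1) else 0, ?_, ?_⟩
  · intro i _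
    dsimp only
    split_ifs with him
    · rw [him, neg_mem_iff, ← pow_mul, monomialIdeal_pow, mul_comm]
      exact Ideal.subset_span ⟨_, hmu, rfl⟩
    · exact Ideal.zero_mem _
  · rw [Finset.sum_eq_single_of_mem m (Finset.mem_Icc.2 ⟨hm, le_rfl⟩)
      (fun i _ him => by simp [him])]
    simp [MvPolynomial.monomial_pow]

/-! ### Associated primes of monomial ideals -/

theorem mem_associatedPrimes_quotient_iff {R : Type*} [CommRing R] [IsNoetherianRing R]
    {J P : Ideal R} : P ∈ associatedPrimes R (R ⧸ J) ↔
      P.IsPrime ∧ ∃ x : R, ∀ s : R, s ∈ P ↔ s * x ∈ J := by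
  rw [AssociatedPrimes.mem_iff, isAssociatedPrime_iff]
  refine and_congr_right fun _ => ⟨?_, ?_⟩
  · rintro ⟨x, rfl⟩
    obtain ⟨x, rfl⟩ := Ideal.Quotient.mk_surjective x
    refine ⟨x, fun s => ?_⟩
    rw [Submodule.mem_colon_singleton, Submodule.mem_bot, ← Ideal.Quotient.eq_zero_iff_mem]
    rfl
  · rintro ⟨x, hx⟩
    refine ⟨Ideal.Quotient.mk J x, ?_⟩
    ext s
    rw [hx, Submodule.mem_colon_singleton, Submodule.mem_bot, ← Ideal.Quotient.eq_zero_iff_mem]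
    rfl

theorem mem_support_mul_monomial {f : MvPolynomial (Fin n) K} {u v : Fin n →₀ ℕ} :
    v ∈ (f * MvPolynomial.monomial u 1).support ↔ ∃ w ∈ f.support, v = w + u := by
  rw [MvPolynomial.mem_support_iff, MvPolynomial.coeff_mul_monomial']
  constructor
  · intro h
    split_ifs at h with huv
    · exact ⟨v - u, by simpa using h, (tsub_add_cancel_of_le huv).symm⟩
    · exact absurd rfl h
  · rintro ⟨w, hw, rfl⟩
    rw [if_pos (self_le_add_left _ _)]
    simpa using hw

/-- Discard from both factors the terms lying in the ideal. No exponent of the reduced product is in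
`latticeSet B 1`, yet the product is in the ideal, so it vanishes and one factor is zero. -/
theorem isPrime_monomialIdeal (hBe : ∀ b ∈ B, ∃ i : Fin n, b = Finsupp.single i 1) :
    (monomialIdeal K (B : Set (Fin n →₀ ℕ))).IsPrime := by
  classical
  refine Ideal.isPrime_iff.2 ⟨fun h => ?_, fun {f g} hfg => ?_⟩
  · rw [Ideal.eq_top_iff_one, mem_monomialIdeal_iff_latticeSet_one] at h
    exact sum_notMem_latticeSet_one hBe (∅ : Finset ℕ) (fun _ => 0) (by simp) (h _ (by simp))
  · have hred : ∀ f : MvPolynomial (Fin n) K, ∃ f' : MvPolynomial (Fin n) K,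
        f - f' ∈ monomialIdeal K (B : Set (Fin n →₀ ℕ)) ∧
        ∀ u ∈ f'.support, u ∉ latticeSet B 1 := by
      intro f
      refine ⟨∑ u ∈ f.support with u ∉ latticeSet B 1, MvPolynomial.monomial u (f.coeff u), ?_, ?_⟩
      · nth_rewrite 1 [f.as_sum]
        rw [← Finset.sum_filter_add_sum_filter_not f.support (fun u => u ∉ latticeSet B 1),
          add_sub_cancel_left]
        refine Ideal.sum_mem _ fun u hu => mem_monomialIdeal_iff_latticeSet_one.2 fun v hv => ?_
        rw [Finset.mem_singleton.1 (MvPolynomial.support_monomial_subset hv)]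
        exact not_not.1 (Finset.mem_filter.1 hu).2
      · intro u hu
        obtain ⟨v, hv, huv⟩ := Finset.mem_biUnion.1 (MvPolynomial.support_sum hu)
        rw [Finset.mem_singleton.1 (MvPolynomial.support_monomial_subset huv)]
        exact (Finset.mem_filter.1 hv).2
    obtain ⟨f', hf', hfU⟩ := hred f
    obtain ⟨g', hg', hgU⟩ := hred g
    have h1 : f' * g' ∈ monomialIdeal K (B : Set (Fin n →₀ ℕ)) := by
      have : f' * g' = f * g - (f * (g - g') + (f - f') * g') := by ring
      rw [this]
      exact Ideal.sub_mem _ hfg (Ideal.add_mem _ (Ideal.mul_mem_left _ _ hg')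
        (Ideal.mul_mem_right _ _ hf'))
    have h2 : f' * g' = 0 := by
      by_contra hne
      obtain ⟨u, hu⟩ := MvPolynomial.support_nonempty.2 hne
      obtain ⟨v, hv, w, hw, rfl⟩ := Finset.mem_add.1 (MvPolynomial.support_mul _ _ hu)
      exact add_notMem_latticeSet_one hBe (hfU v hv) (hgU w hw)
        (mem_monomialIdeal_iff_latticeSet_one.1 h1 _ hu)
    rcases mul_eq_zero.1 h2 with rfl | rfl
    · exact .inl (by simpa using hf')
    · exact .inr (by simpa using hg')

theorem IsSolution.mul_monomial_mem_iff (hA : A.Nonempty) {k : ℕ} {c : Fin n →₀ ℕ}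
    (hc : IsSolution A B k c) (s : MvPolynomial (Fin n) K) :
    s * MvPolynomial.monomial c 1 ∈
      (closurePowers (monomialIdeal K (A : Set (Fin n →₀ ℕ)))).toFun k ↔
      s ∈ monomialIdeal K (B : Set (Fin n →₀ ℕ)) := by
  rw [mem_closurePowers hA, mem_monomialIdeal_iff_latticeSet_one]
  constructor
  · intro h u hu
    rw [← hc, add_comm]
    exact h _ (mem_support_mul_monomial.2 ⟨u, hu, rfl⟩)
  · intro h u hu
    obtain ⟨w, hw, rfl⟩ := mem_support_mul_monomial.1 hu
    rw [add_comm]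
    exact (hc w).2 (h w hw)

/-- The integer program has a solution if and only if the prime `I(B)` is associated to the
integral closure of `I(A) ^ k`. -/
theorem exists_isSolution_iff_mem_associatedPrimes (hA : A.Nonempty)
    (hBe : ∀ b ∈ B, ∃ i : Fin n, b = Finsupp.single i 1) {k : ℕ} :
    (∃ c, IsSolution A B k c) ↔ monomialIdeal K (B : Set (Fin n →₀ ℕ)) ∈
      associatedPrimes (MvPolynomial (Fin n) K) (MvPolynomial (Fin n) K ⧸
        (closurePowers (monomialIdeal K (A : Set (Fin n →₀ ℕ)))).toFun k) := by
  rw [mem_associatedPrimes_quotient_iff]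
  constructor
  · rintro ⟨c, hc⟩
    exact ⟨isPrime_monomialIdeal hBe, MvPolynomial.monomial c 1,
      fun s => (hc.mul_monomial_mem_iff hA s).symm⟩
  · rintro ⟨-, f, hf⟩
    by_contra! hno
    -- If no exponent of `f` is a solution, each has a multiplier outside `latticeSet B 1`. The sum
    -- of these multipliers sends `f` into the closure, contradicting primality.
    have hd : ∀ u ∈ f.support, ∃ d, u + d ∈ closedLatticeSet A k ∧ d ∉ latticeSet B 1 := by
      intro u hu
      have h1 := hno u
      unfold IsSolution at h1
      push Not at h1
      obtain ⟨d, h2 | ⟨h2, h3⟩⟩ := h1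
      · exact ⟨d, h2⟩
      · refine absurd ?_ h2
        obtain ⟨b, hb, hbd⟩ := mem_latticeSet_one.1 h3
        have h4 : MvPolynomial.monomial b (1 : K) * f ∈
            (closurePowers (monomialIdeal K (A : Set (Fin n →₀ ℕ)))).toFun k :=
          (hf _).1 (Ideal.subset_span ⟨b, hb, rfl⟩)
        rw [mul_comm] at h4
        exact closedLatticeSet_mono ((mem_closurePowers hA).1 h4 _
          (mem_support_mul_monomial.2 ⟨u, hu, rfl⟩)) (add_le_add_right hbd u)
    choose! d hdA hdB using hd
    refine sum_notMem_latticeSet_one hBe f.support d hdB ?_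
    have h5 : MvPolynomial.monomial (∑ u ∈ f.support, d u) (1 : K) * f ∈
        (closurePowers (monomialIdeal K (A : Set (Fin n →₀ ℕ)))).toFun k := by
      rw [mul_comm, mem_closurePowers hA]
      intro v hv
      obtain ⟨u, hu, rfl⟩ := mem_support_mul_monomial.1 hv
      exact closedLatticeSet_mono (hdA u hu)
        (add_le_add_right (Finset.single_le_sum (fun _ _ => zero_le) hu) u)
    exact mem_monomialIdeal_iff_latticeSet_one.1 ((hf _).2 h5) _ (by simp)

theorem card_support_sub_monomial_lt {f : MvPolynomial (Fin n) K} {u : Fin n →₀ ℕ}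
    (hu : u ∈ f.support) :
    (f - MvPolynomial.monomial u (f.coeff u)).support.card < f.support.card := by
  classical
  refine Finset.card_lt_card ⟨fun v hv => ?_, fun h => ?_⟩
  · rw [MvPolynomial.mem_support_iff, MvPolynomial.coeff_sub, MvPolynomial.coeff_monomial] at hv
    by_cases huv : u = v
    · exact huv ▸ hu
    · rwa [if_neg huv, sub_zero, ← MvPolynomial.mem_support_iff] at hv
  · have := h hu
    simp [MvPolynomial.coeff_monomial] at this

/-- The associated primes of a monomial ideal are generated by variables. -/
theorem exists_eq_monomialIdeal_of_mem_associatedPrimes {U : Set (Fin n →₀ ℕ)}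
    {J : Ideal (MvPolynomial (Fin n) K)} (hJ : ∀ f, f ∈ J ↔ ∀ u ∈ f.support, u ∈ U)
    {P : Ideal (MvPolynomial (Fin n) K)}
    (hP : P ∈ associatedPrimes (MvPolynomial (Fin n) K) (MvPolynomial (Fin n) K ⧸ J)) :
    ∃ T : Finset (Fin n),
      P = monomialIdeal K ((T.image fun i => Finsupp.single i 1 : Finset (Fin n →₀ ℕ)) :
        Set (Fin n →₀ ℕ)) := by
  classical
  obtain ⟨hprime, hex⟩ := mem_associatedPrimes_quotient_iff.1 hP
  obtain ⟨x, hx, hmin⟩ := WellFounded.has_min (measure fun x : MvPolynomial (Fin n) K =>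
    x.support.card).wf {x | ∀ s, s ∈ P ↔ s * x ∈ J} hex
  have hx0 : x ≠ 0 := by
    rintro rfl
    exact hprime.ne_top ((Ideal.eq_top_iff_one _).2 ((hx 1).2 (by simp)))
  let o : MonomialOrder (Fin n) := MonomialOrder.lex
  -- Let `x` be a witness with fewest terms. Were the leading monomial of `s` not in `P`,
  -- multiplying `x` by it and dropping the leading term, which lands in `J`, would give a witness
  -- with fewer terms.
  have hlead : ∀ s ∈ P, s ≠ 0 → MvPolynomial.monomial (o.degree s) (1 : K) ∈ P := by
    intro s hs hs0
    by_contra hnot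
    have hU : o.degree s + o.degree x ∈ U := by
      rw [← o.degree_mul hs0 hx0]
      exact (hJ _).1 ((hx s).1 hs) _ (o.degree_mem_support (mul_ne_zero hs0 hx0))
    have hxs := o.degree_mem_support hx0
    set y := (x - MvPolynomial.monomial (o.degree x) (x.coeff (o.degree x))) *
      MvPolynomial.monomial (o.degree s) 1 with hy
    refine hmin y (fun r => ?_) ?_
    · have h1 : r * MvPolynomial.monomial (o.degree s) 1 * x = r * y +
          r * MvPolynomial.monomial (o.degree s + o.degree x) (x.coeff (o.degree x)) := by
        have h2 : MvPolynomial.monomial (o.degree s + o.degree x) (x.coeff (o.degree x)) =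
            MvPolynomial.monomial (o.degree s) 1 *
              MvPolynomial.monomial (o.degree x) (x.coeff (o.degree x)) := by
          rw [MvPolynomial.monomial_mul, one_mul]
        rw [hy, h2]
        ring
      have h3 : r * MvPolynomial.monomial (o.degree s + o.degree x) (x.coeff (o.degree x)) ∈ J := by
        refine Ideal.mul_mem_left _ _ ((hJ _).2 fun v hv => ?_)
        rwa [Finset.mem_singleton.1 (MvPolynomial.support_monomial_subset hv)]
      rw [← Ideal.add_mem_iff_left _ h3, ← h1, ← hx]
      exact ⟨fun h => Ideal.mul_mem_right _ _ h, fun h => (hprime.mem_or_mem h).resolve_right hnot⟩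
    · refine lt_of_le_of_lt ?_ (card_support_sub_monomial_lt hxs)
      refine (Finset.card_le_card (t := (x - MvPolynomial.monomial (o.degree x)
        (x.coeff (o.degree x))).support.image (· + o.degree s)) fun v hv => ?_).trans
        Finset.card_image_le
      obtain ⟨w, hw, rfl⟩ := mem_support_mul_monomial.1 hv
      exact Finset.mem_image_of_mem _ hw
  have hmon : ∀ N : ℕ, ∀ s ∈ P, s.support.card = N →
      ∀ u ∈ s.support, MvPolynomial.monomial u (1 : K) ∈ P := by
    intro N
    induction N using Nat.strong_induction_on with
    | _ N ih =>
      rintro s hs rfl u hu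
      have hs0 : s ≠ 0 := MvPolynomial.support_nonempty.1 ⟨u, hu⟩
      have h1 := hlead s hs hs0
      by_cases hud : u = o.degree s
      · rwa [hud]
      · have h2 : s - MvPolynomial.monomial (o.degree s) (s.coeff (o.degree s)) ∈ P := by
          refine Ideal.sub_mem _ hs ?_
          rw [← mul_one (s.coeff _), ← MvPolynomial.C_mul_monomial]
          exact Ideal.mul_mem_left _ _ h1
        refine ih _ (card_support_sub_monomial_lt (o.degree_mem_support hs0)) _ h2 rfl u ?_
        rwa [MvPolynomial.mem_support_iff, MvPolynomial.coeff_sub, MvPolynomial.coeff_monomial,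
          if_neg (Ne.symm hud), sub_zero, ← MvPolynomial.mem_support_iff]
  refine ⟨Finset.univ.filter fun i => MvPolynomial.X i ∈ P, le_antisymm (fun s hs => ?_) ?_⟩
  · rw [mem_monomialIdeal]
    intro u hu
    have h1 := hmon _ s hs rfl u hu
    rw [MvPolynomial.monomial_eq, map_one, one_mul, Finsupp.prod, hprime.prod_mem_iff] at h1
    obtain ⟨i, hi, h2⟩ := h1
    refine ⟨Finsupp.single i 1, ?_, ?_⟩
    · exact Finset.mem_image_of_mem _ (Finset.mem_filter.2
        ⟨Finset.mem_univ _, hprime.mem_of_pow_mem _ h2⟩)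
    · rw [Finsupp.single_le_iff]
      exact Nat.one_le_iff_ne_zero.2 (Finsupp.mem_support_iff.1 hi)
  · unfold monomialIdeal
    rw [Ideal.span_le]
    rintro _ ⟨_, hb, rfl⟩
    rw [Finset.mem_coe, Finset.mem_image] at hb
    obtain ⟨i, hi, rfl⟩ := hb
    exact (Finset.mem_filter.1 hi).2

theorem exists_eq_of_mem_image_single (T : Finset (Fin n)) (b : Fin n →₀ ℕ)
    (hb : b ∈ T.image fun i => Finsupp.single i 1) : ∃ i : Fin n, b = Finsupp.single i 1 := by
  obtain ⟨i, -, rfl⟩ := Finset.mem_image.1 hb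
  exact ⟨i, rfl⟩

theorem associatedPrimes_closurePowers_mono (hA : A.Nonempty) {k l : ℕ} (hkl : k ≤ l) :
    associatedPrimes (MvPolynomial (Fin n) K) (MvPolynomial (Fin n) K ⧸
        (closurePowers (monomialIdeal K (A : Set (Fin n →₀ ℕ)))).toFun k) ⊆
      associatedPrimes (MvPolynomial (Fin n) K) (MvPolynomial (Fin n) K ⧸
        (closurePowers (monomialIdeal K (A : Set (Fin n →₀ ℕ)))).toFun l) := by
  intro P hP
  obtain ⟨T, rfl⟩ := exists_eq_monomialIdeal_of_mem_associatedPrimes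
    (fun f => mem_closurePowers hA) hP
  have hT := exists_eq_of_mem_image_single T
  obtain ⟨c, hc⟩ := (exists_isSolution_iff_mem_associatedPrimes hA hT).2 hP
  exact (exists_isSolution_iff_mem_associatedPrimes hA hT).1 (hc.exists_of_le hA hT hkl)

theorem mem_assInfty_of_mem_associatedPrimes (hA : A.Nonempty) {k : ℕ}
    {P : Ideal (MvPolynomial (Fin n) K)}
    (hP : P ∈ associatedPrimes (MvPolynomial (Fin n) K) (MvPolynomial (Fin n) K ⧸
        (closurePowers (monomialIdeal K (A : Set (Fin n →₀ ℕ)))).toFun k)) :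
    P ∈ (closurePowers (monomialIdeal K (A : Set (Fin n →₀ ℕ)))).assInfty :=
  (Set.Ici_infinite k).mono fun _ hl => associatedPrimes_closurePowers_mono hA hl hP

theorem finite_assInfty_closurePowers (hA : A.Nonempty) :
    (closurePowers (monomialIdeal K (A : Set (Fin n →₀ ℕ)))).assInfty.Finite := by
  refine (Set.finite_range fun T : Finset (Fin n) => monomialIdeal K
    ((T.image fun i => Finsupp.single i 1 : Finset (Fin n →₀ ℕ)) : Set (Fin n →₀ ℕ))).subset ?_
  intro P hP
  obtain ⟨k, hk⟩ := hP.nonempty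
  obtain ⟨T, rfl⟩ := exists_eq_monomialIdeal_of_mem_associatedPrimes
    (fun f => mem_closurePowers hA) hk
  exact ⟨T, rfl⟩

/-- Solvability for all large `k` amounts to asymptotic associatedness of the prime `I(B)`. -/
theorem eventually_exists_isSolution_iff_mem_assInfty (hA : A.Nonempty)
    (hBe : ∀ b ∈ B, ∃ i : Fin n, b = Finsupp.single i 1) :
    (∀ᶠ k : ℕ in atTop, ∃ c, IsSolution A B k c) ↔ monomialIdeal K (B : Set (Fin n →₀ ℕ)) ∈
      (closurePowers (monomialIdeal K (A : Set (Fin n →₀ ℕ)))).assInfty := by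
  constructor
  · intro h
    obtain ⟨k, hk⟩ := h.exists
    exact mem_assInfty_of_mem_associatedPrimes hA
      ((exists_isSolution_iff_mem_associatedPrimes hA hBe).1 hk)
  · intro h
    obtain ⟨k, hk⟩ := h.nonempty
    obtain ⟨c, hc⟩ := (exists_isSolution_iff_mem_associatedPrimes hA hBe).2 hk
    filter_upwards [eventually_ge_atTop k] with l hl
    exact hc.exists_of_le hA hBe hl

end MonomialIdeals

/-! ### The Rees algebra and vanishing of `Soc` -/

namespace IdealFiltration

variable {R : Type*} [CommRing R] (F : IdealFiltration R)

/-- The homogeneous element `r tᵏ` of the Rees algebra. -/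
noncomputable def reesMonomial (k : ℕ) (r : R) (hr : r ∈ F.toFun k) : F.ReesRing :=
  (⟨monomial k r, fun j => by
    rw [coeff_monomial]
    split_ifs with h
    · exact h ▸ hr
    · exact Ideal.zero_mem _⟩ : F.rees)

theorem reesVal_reesMonomial {k : ℕ} {r : R} (hr : r ∈ F.toFun k) :
    F.reesVal (F.reesMonomial k r hr) = monomial k r := rfl

variable {F}

theorem mem_reesShift_colon_map {J : Ideal R} {f : F.ReesRing} :
    f ∈ F.reesShift.colon (J.map (algebraMap R F.ReesRing) : Set F.ReesRing) ↔
      ∀ k, ∀ s ∈ J, (F.reesVal f).coeff k * s ∈ F.toFun (k + 1) := by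
  have hval : ∀ s, F.reesVal (f * algebraMap R F.ReesRing s) = F.reesVal f * C s := by
    intro s
    rw [map_mul, AlgHom.commutes]
    rfl
  rw [Submodule.mem_colon]
  constructor
  · intro h k s hs
    have h1 : f • algebraMap R F.ReesRing s ∈ F.reesShift := h _ (Ideal.mem_map_of_mem _ hs)
    have h2 := h1 k
    rwa [smul_eq_mul, hval, coeff_mul_C] at h2
  · intro h
    have hle : J.map (algebraMap R F.ReesRing) ≤ F.reesShift.colon {f} := by
      rw [Ideal.map_le_iff_le_comap]
      intro s hs
      rw [Ideal.mem_comap, Submodule.mem_colon_singleton, smul_eq_mul, mul_comm]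
      intro k
      rw [hval, coeff_mul_C]
      exact h k s hs
    intro x hx
    have := Submodule.mem_colon_singleton.1 (hle hx)
    rwa [smul_eq_mul, mul_comm] at this

theorem mem_socNum {p : Ideal R} {f : F.ReesRing} :
    f ∈ F.socNum p ↔ ∀ k, ∀ s ∈ p, (F.reesVal f).coeff k * s ∈ F.toFun (k + 1) :=
  mem_reesShift_colon_map

theorem mem_socDen {p : Ideal R} {f : F.ReesRing} :
    f ∈ F.socDen p ↔ ∃ N : ℕ, ∀ k, ∀ s ∈ p ⊔ F.socProd p ^ N,
      (F.reesVal f).coeff k * s ∈ F.toFun (k + 1) := by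
  rw [socDen, Submodule.mem_iSup_of_directed]
  · exact exists_congr fun N => mem_reesShift_colon_map
  · refine Monotone.directed_le fun M N hMN => ?_
    exact Submodule.colon_mono le_rfl
      (Ideal.map_mono (sup_le_sup_left (Ideal.pow_le_pow_right hMN) p))

/-- Finiteness matters: `finprod` takes the default value 1 on infinite support. -/
theorem socProd_eq_prod {p : Ideal R} (hfin : {p' | p' ∈ F.assInfty ∧ p < p'}.Finite) :
    F.socProd p = ∏ p' ∈ hfin.toFinset, p' :=
  finprod_mem_eq_finite_toFinset_prod _ hfin

theorem socProd_le {p p' : Ideal R} (hfin : F.assInfty.Finite) (hp' : p' ∈ F.assInfty)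
    (hlt : p < p') : F.socProd p ≤ p' := by
  have hfin' := hfin.subset (Set.sep_subset F.assInfty (p < ·))
  rw [socProd_eq_prod hfin']
  exact Ideal.le_of_dvd (Finset.dvd_prod_of_mem (fun x : Ideal R => x)
    (hfin'.mem_toFinset.2 ⟨hp', hlt⟩))

theorem not_socProd_pow_le {p : Ideal R} (hp : p.IsPrime) (hfin : F.assInfty.Finite) (N : ℕ) :
    ¬ F.socProd p ^ N ≤ p := by
  intro h
  have hfin' := hfin.subset (Set.sep_subset F.assInfty (p < ·))
  have h1 := hp.le_of_pow_le h
  rw [socProd_eq_prod hfin', hp.prod_le] at h1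
  obtain ⟨p', hp', hle⟩ := h1
  exact (hfin'.mem_toFinset.1 hp').2.not_ge hle

/-- For each coefficient `r` of `f`, the minimal primes of its colon ideal `J` lie in `Ass^∞` and
contain `p`, strictly since `p` is not in `Ass^∞`. Hence each contains `𝔮`, and a power of `𝔮` lies
in `J`. -/
theorem socNum_le_socDen [IsNoetherianRing R] {p : Ideal R} (hfin : F.assInfty.Finite)
    (hmono : ∀ k, associatedPrimes R (R ⧸ F.toFun k) ⊆ F.assInfty) (hp : p ∉ F.assInfty) :
    F.socNum p ≤ F.socDen p := by
  intro f hf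
  rw [mem_socNum] at hf
  rw [mem_socDen]
  have hN : ∀ k, ∃ N : ℕ, ∀ s ∈ F.socProd p ^ N, (F.reesVal f).coeff k * s ∈ F.toFun (k + 1) := by
    intro k
    set J := (F.toFun (k + 1)).colon {(F.reesVal f).coeff k} with hJ
    have hmem : ∀ s, s ∈ J ↔ (F.reesVal f).coeff k * s ∈ F.toFun (k + 1) := fun s => by
      rw [hJ, Submodule.mem_colon_singleton, smul_eq_mul, mul_comm]
    have hrad : F.socProd p ≤ J.radical := by
      rw [Ideal.radical_eq_sInf]
      refine le_sInf ?_
      rintro P ⟨hJP, hP⟩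
      obtain ⟨Q, hQ, hQP⟩ := Ideal.exists_minimalPrimes_le hJP
      refine le_trans ?_ hQP
      have hQass : Q ∈ associatedPrimes R (R ⧸ J) := by
        apply Module.associatedPrimes.minimalPrimes_annihilator_subset_associatedPrimes
        rwa [Ideal.annihilator_quotient]
      obtain ⟨hQprime, x, hx⟩ := mem_associatedPrimes_quotient_iff.1 hQass
      have hQinf : Q ∈ F.assInfty := by
        refine hmono (k + 1) (mem_associatedPrimes_quotient_iff.2
          ⟨hQprime, (F.reesVal f).coeff k * x, fun s => ?_⟩)
        rw [hx, hmem, mul_left_comm]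
      refine socProd_le hfin hQinf (lt_of_le_of_ne ?_ ?_)
      · exact le_trans (fun s hs => (hmem s).2 (hf k s hs)) hQ.1.2
      · rintro rfl
        exact hp hQinf
    obtain ⟨N, hN⟩ := Ideal.exists_pow_le_of_le_radical_of_fg hrad (IsNoetherian.noetherian _)
    exact ⟨N, fun s hs => (hmem s).1 (hN hs)⟩
  choose N hN using hN
  -- Only finitely many coefficients are nonzero, so one exponent serves them all.
  refine ⟨(F.reesVal f).support.sup N, fun k s hs => ?_⟩
  by_cases hk : k ∈ (F.reesVal f).support
  · obtain ⟨y, hy, z, hz, rfl⟩ := Submodule.mem_sup.1 hs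
    rw [mul_add]
    exact Ideal.add_mem _ (hf k y hy)
      (hN k z (Ideal.pow_le_pow_right (Finset.le_sup (f := N) hk) hz))
  · rw [notMem_support_iff.1 hk, zero_mul]
    exact Ideal.zero_mem _

theorem mem_assInfty_of_supportDim_soc_pos [IsNoetherianRing R] {p : Ideal R}
    (hfin : F.assInfty.Finite) (hmono : ∀ k, associatedPrimes R (R ⧸ F.toFun k) ⊆ F.assInfty)
    (h : 0 < Module.supportDim F.ReesRing (F.Soc p)) : p ∈ F.assInfty := by
  by_contra hp
  have htop : (F.socDen p).submoduleOf (F.socNum p) = ⊤ :=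
    Submodule.submoduleOf_eq_top.2 (socNum_le_socDen hfin hmono hp)
  have : Subsingleton (F.Soc p) := Submodule.Quotient.subsingleton_iff.2 htop
  rw [Module.supportDim_eq_bot_of_subsingleton] at h
  exact not_lt_bot h

end IdealFiltration

/-! ### Positive dimension of `Soc` -/

/-- A module with an element that is not killed by any `τ ^ i * (1 - τ * g)` has a support of
positive dimension. -/
theorem Module.supportDim_pos_of_forall_smul_ne_zero {R M : Type*} [CommRing R] [AddCommGroup M]
    [Module R M] (ξ : M) (τ : R) (h : ∀ (i : ℕ) (g : R), (τ ^ i * (1 - τ * g)) • ξ ≠ 0) :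
    0 < Module.supportDim R M := by
  -- A prime disjoint from `T` avoids `τ`, and it stays proper when `τ` is adjoined because `T`
  -- contains every `1 - τ * g`.
  let T : Submonoid R :=
    { carrier := {x | ∃ (i : ℕ) (g : R), x = τ ^ i * (1 - τ * g)}
      one_mem' := ⟨0, 0, by simp⟩
      mul_mem' := by
        rintro _ _ ⟨i, g, rfl⟩ ⟨j, g', rfl⟩
        exact ⟨i + j, g + g' - τ * g * g', by ring⟩ }
  have hdisj : Disjoint ((Submodule.span R {ξ}).annihilator : Set R) T := by
    rw [Set.disjoint_left]
    rintro _ hx ⟨i, g, rfl⟩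
    exact h i g ((Submodule.mem_annihilator_span_singleton _ _).1 hx)
  obtain ⟨P, hP, hle, hPT⟩ := Ideal.exists_le_prime_disjoint _ T hdisj
  rw [Set.disjoint_left] at hPT
  have hτ : τ ∉ P := fun hmem => hPT hmem ⟨1, 0, by simp⟩
  have hne : P ⊔ Ideal.span {τ} ≠ ⊤ := by
    rw [Ne, Ideal.eq_top_iff_one, Submodule.mem_sup]
    rintro ⟨y, hy, z, hz, hyz⟩
    obtain ⟨g, rfl⟩ := Ideal.mem_span_singleton'.1 hz
    refine hPT hy ⟨0, g, ?_⟩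
    rw [pow_zero, one_mul, ← hyz]
    ring
  obtain ⟨Q, hQ, hPQ⟩ := Ideal.exists_le_maximal _ hne
  have hlt : P < Q := lt_of_le_of_ne (le_sup_left.trans hPQ) fun heq =>
    hτ (heq ▸ hPQ (Ideal.mem_sup_right (Ideal.mem_span_singleton_self τ)))
  rw [Module.supportDim, Order.krullDim_pos_iff]
  exact ⟨⟨⟨P, hP⟩, Module.mem_support_iff_exists_annihilator.2 ⟨ξ, hle⟩⟩,
    ⟨⟨Q, hQ.isPrime⟩, Module.mem_support_iff_exists_annihilator.2 ⟨ξ, hle.trans hlt.le⟩⟩, hlt⟩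

theorem supportDim_soc_pos {K : Type*} [Field K] {n : ℕ} {A B : Finset (Fin n →₀ ℕ)}
    (hA : A.Nonempty) (hBe : ∀ b ∈ B, ∃ i : Fin n, b = Finsupp.single i 1)
    (hsol : ∃ k c, IsSolution A B k c) :
    0 < Module.supportDim (closurePowers (monomialIdeal K (A : Set (Fin n →₀ ℕ)))).ReesRing
      ((closurePowers (monomialIdeal K (A : Set (Fin n →₀ ℕ)))).Soc
        (monomialIdeal K (B : Set (Fin n →₀ ℕ)))) := by
  obtain ⟨m, c, hc, hcm⟩ := exists_isSolution_mem hBe hsol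
  obtain ⟨a, ha, hray⟩ := hc.exists_isRay hA hBe
  set F := closurePowers (monomialIdeal K (A : Set (Fin n →₀ ℕ))) with hF
  set p := monomialIdeal K (B : Set (Fin n →₀ ℕ)) with hp
  have hmem : ∀ k, ∀ u ∈ closedLatticeSet A k, MvPolynomial.monomial u (1 : K) ∈ F.toFun k := by
    intro k u hu
    rw [hF, mem_closurePowers hA]
    intro v hv
    rwa [Finset.mem_singleton.1 (MvPolynomial.support_monomial_subset hv)]
  let x := F.reesMonomial m _ (hmem m c hcm)
  let τ := F.reesMonomial 1 _ (hmem 1 a (mem_closedLatticeSet_one ha))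
  have hx : x ∈ F.socNum p := by
    rw [IdealFiltration.mem_socNum]
    intro k s hs
    rw [IdealFiltration.reesVal_reesMonomial, coeff_monomial]
    split_ifs with hk
    · subst hk
      rw [mul_comm]
      exact (hc.mul_monomial_mem_iff hA s).2 hs
    · rw [zero_mul]
      exact Ideal.zero_mem _
  refine Module.supportDim_pos_of_forall_smul_ne_zero
    (Submodule.Quotient.mk ⟨x, hx⟩ : F.Soc p) τ fun i g h0 => ?_
  rw [← Submodule.Quotient.mk_smul, Submodule.Quotient.mk_eq_zero] at h0
  have hden : τ ^ i * (1 - τ * g) * x ∈ F.socDen p := h0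
  obtain ⟨N, hN⟩ := IdealFiltration.mem_socDen.1 hden
  refine IdealFiltration.not_socProd_pow_le (isPrime_monomialIdeal (K := K) hBe)
    (finite_assInfty_closurePowers hA) N fun s hs => ?_
  have h1 := hN (m + i) s (Ideal.mem_sup_right hs)
  -- The product `τ * g` has no term of degree 0, so only the 1 contributes. The colon of `x^(c + i
  -- • a)` at level `m + i + 1` is exactly `p`, which contains no power of `𝔮`.
  have hcoeff : (F.reesVal (τ ^ i * (1 - τ * g) * x)).coeff (m + i) =
      MvPolynomial.monomial (c + i • a) 1 := by
    have hval : F.reesVal (τ ^ i * (1 - τ * g) * x) =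
        monomial (m + i) (MvPolynomial.monomial (c + i • a) (1 : K)) *
          (1 - monomial 1 (MvPolynomial.monomial a 1) * F.reesVal g) := by
      simp only [map_mul, map_pow, map_sub, map_one]
      rw [IdealFiltration.reesVal_reesMonomial, IdealFiltration.reesVal_reesMonomial,
        monomial_pow, MvPolynomial.monomial_pow, one_mul, one_pow, mul_right_comm,
        monomial_mul_monomial, MvPolynomial.monomial_mul, one_mul, add_comm i, add_comm (i • a)]
    have h2 := coeff_monomial_mul (1 - monomial 1 (MvPolynomial.monomial a (1 : K)) * F.reesVal g)
      (m + i) 0 (MvPolynomial.monomial (c + i • a) (1 : K))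
    rw [zero_add] at h2
    rw [hval, h2, coeff_sub, mul_coeff_zero, coeff_monomial, if_neg one_ne_zero]
    simp
  rw [hcoeff, mul_comm, add_right_comm] at h1
  exact ((hray i).mul_monomial_mem_iff hA s).1 h1

theorem theorem3p2 (K : Type*) [Field K] (n : ℕ) (A B : Finset (Fin n →₀ ℕ))
    (hA : A.Nonempty) (hB : B.Nonempty) (hA0 : (0 : Fin n →₀ ℕ) ∉ A)
    (hBe : ∀ b ∈ B, ∃ i : Fin n, b = Finsupp.single i 1) :
    List.TFAE
      [ ∀ᶠ k : ℕ in atTop, ∃ c : Fin n →₀ ℕ, IsSolution A B k c,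
        monomialIdeal K (B : Set (Fin n →₀ ℕ)) ∈
          (closurePowers (monomialIdeal K (A : Set (Fin n →₀ ℕ)))).assInfty,
        0 < Module.supportDim (closurePowers (monomialIdeal K (A : Set (Fin n →₀ ℕ)))).ReesRing
          ((closurePowers (monomialIdeal K (A : Set (Fin n →₀ ℕ)))).Soc
            (monomialIdeal K (B : Set (Fin n →₀ ℕ)))) ] ∧
    ((∀ᶠ k : ℕ in atTop, ∃ c : Fin n →₀ ℕ, IsSolution A B k c) →
      ∃ f : ℕ → ℕ, IsEventuallyQuasiLinear f ∧
        ∀ᶠ k : ℕ in atTop, (∃ c, IsOptimalSolution A B k c) ∧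
          ∀ c, IsOptimalSolution A B k c → c.degree = f k) := by
  refine ⟨?_, exists_isEventuallyQuasiLinear_degree hA hB hBe⟩
  tfae_have 1 ↔ 2 := eventually_exists_isSolution_iff_mem_assInfty hA hBe
  tfae_have 1 → 3 := fun h => supportDim_soc_pos hA hBe h.exists
  tfae_have 3 → 2 := IdealFiltration.mem_assInfty_of_supportDim_soc_pos
    (finite_assInfty_closurePowers hA) fun _ _ => mem_assInfty_of_mem_associatedPrimes hA
  tfae_finish
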